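/- Let $T>0$, $p\ge 1$, $s=1/p$, $f(u)=|u|^{p+1}/(p+1)$, let $h:\mathbb R\to\mathbb R$ be Lipschitz and $g=h\circ f'$. For $\sigma>0$ and $w:\mathbb R\to\mathbb R$ put $TV^{\sigma}w=\sup\sum_{i=1}^{n}|w(x_i)-w(x_{i-1})|^{1/\sigma}$, the supremum being over all finite subdivisions $x_0<x_1<\dots<x_n$ of $\mathbb R$. Then there exist compactly supported initial data $u_0,v_0\in L^\infty(\mathbb R)$ and an entropy solution $(u,v)$ on $[0,T]\times\mathbb R$ of the triangular system $$u_t+f(u)_x=0,\qquad v_t+(g(u)v)_x=0,\qquad (u,v)(\cdot,0)=(u_0,v_0),$$ with $u,v\in L^\infty([0,T]\times\mathbb R)$, such that for every $t\in[0,T]$ $$TV^{s+\varepsilon}u(\cdot,t)=\infty\ \text{ for all }\varepsilon>0,\qquad TV^{s'}v(\cdot,t)=\infty\ \text{ for all }s'\in(0,1],$$ for every representative of $u(\cdot,t)$ and of $v(\cdot,t)$ modulo null sets. Here "entropy solution" means that $u\in C([0,T];L^1_{\rm loc}(\mathbb R))$ is the Kruzhkov entropy solution of the first equation and that $v$ solves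 the second one in the sense of distributions, with the weak formulation holding on $[0,t]\times\mathbb R$ for every $t\in[0,T]$. Moreover $u$ has a representative that is continuous on $[0,T]\times\mathbb R$, and $v$ is obtained by characteristics: for this representative and every $x_0\in\mathbb R$ the problem $\frac{d}{dt}X(t,x_0)=g(u(X(t,x_0),t))$, $X(0,x_0)=x_0$ has exactly one solution on $[0,T]$, each $X(t,\cdot)$, $t\in[0,T]$, is a homeomorphism of $\mathbb R$, and the (signed) measure $v(x,t)\,dx$ is the image of $v_0(x)\,dx$ under $X(t,\cdot)$. -/

import Mathlib

open MeasureTheory Filter Topology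
open scoped ENNReal NNReal ContDiff

noncomputable section

/-- The total `s`-variation of a real function on the line: the supremum over all finite subdivisions
`x 0 < x 1 < ⋯ < x n` of `∑ |w (x (i+1)) - w (x i)| ^ (1/s)`. -/
def fracTV (s : ℝ) (w : ℝ → ℝ) : ℝ≥0∞ :=
  ⨆ (n : ℕ) (x : ℕ → ℝ) (_ : StrictMonoOn x (Set.Iic n)),
    ∑ i ∈ Finset.range n, ENNReal.ofReal (|w (x (i + 1)) - w (x i)| ^ (1 / s))

/-- The convex power-law flux `|u|^(p+1) / (p+1)`. -/
def powerFlux (p : ℝ) (u : ℝ) : ℝ := |u| ^ (p + 1) / (p + 1)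

/-- Lebesgue measure on the strip `[0,T] × ℝ` of points `(t, x)`. -/
def stripMeasure (T : ℝ) : Measure (ℝ × ℝ) :=
  (volume : Measure (ℝ × ℝ)).restrict (Set.Icc 0 T ×ˢ Set.univ)

/-- Test functions `φ (t, x)`: smooth with compact support in the plane. In particular they need not
vanish at `t = 0`. -/
structure IsTestFunction (φ : ℝ × ℝ → ℝ) : Prop where
  smooth : ContDiff ℝ ∞ φ
  compact : HasCompactSupport φ

/-- The partial derivative of `φ (t, x)` in time. -/
def partialT (φ : ℝ × ℝ → ℝ) (t x : ℝ) : ℝ := deriv (fun τ => φ (τ, x)) t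

/-- The partial derivative of `φ (t, x)` in space. -/
def partialX (φ : ℝ × ℝ → ℝ) (t x : ℝ) : ℝ := deriv (fun y => φ (t, y)) x

/-- `u t x` is the (bounded, Kruzhkov) entropy solution on `[0,T] × ℝ` of `u_t + f(u)_x = 0` with
initial value `u₀`: it satisfies the Kruzhkov inequality for every constant `k`, and it is continuous
in time with values in `L¹_loc`, so that `u t` is determined almost everywhere for every `t`. -/
structure IsEntropySolution (f : ℝ → ℝ) (T : ℝ) (u₀ : ℝ → ℝ) (u : ℝ → ℝ → ℝ) : Prop where
  bounded : MemLp (Function.uncurry u) ⊤ (stripMeasure T)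
  slice_bounded : ∀ t ∈ Set.Icc 0 T, MemLp (u t) ⊤ volume
  initial : u 0 =ᵐ[volume] u₀
  continuous_L1loc : ∀ R : ℝ, ∀ t ∈ Set.Icc 0 T,
    Tendsto (fun τ => ∫ x in Set.Icc (-R) R, |u τ x - u t x|) (𝓝[Set.Icc 0 T] t) (𝓝 0)
  entropy : ∀ (k : ℝ) (φ : ℝ × ℝ → ℝ), IsTestFunction φ → (∀ z, 0 ≤ φ z) →
    (∀ t x, T ≤ t → φ (t, x) = 0) →
    0 ≤ (∫ t in (0 : ℝ)..T, ∫ x : ℝ,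
          (|u t x - k| * partialT φ t x
            + Real.sign (u t x - k) * (f (u t x) - f k) * partialX φ t x))
        + ∫ x : ℝ, |u₀ x - k| * φ (0, x)

/-- `v t x` is a bounded distributional solution on `[0,T] × ℝ` of the linear conservative transport
equation `v_t + (c v)_x = 0` with initial value `v₀`. The weak formulation is required on `[0,t]` for
every `t ≤ T`, so that `v t` is determined almost everywhere for every `t` (it is weakly-* continuous
in time). -/
structure IsWeakTransportSolution (c : ℝ → ℝ → ℝ) (T : ℝ) (v₀ : ℝ → ℝ) (v : ℝ → ℝ → ℝ) :
    Prop where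
  bounded : MemLp (Function.uncurry v) ⊤ (stripMeasure T)
  slice_bounded : ∀ t ∈ Set.Icc 0 T, MemLp (v t) ⊤ volume
  initial : v 0 =ᵐ[volume] v₀
  weak : ∀ φ : ℝ × ℝ → ℝ, IsTestFunction φ → ∀ t ∈ Set.Icc 0 T,
    ∫ x : ℝ, v t x * φ (t, x) =
      (∫ x : ℝ, v₀ x * φ (0, x))
        + ∫ τ in (0 : ℝ)..t, ∫ x : ℝ, v τ x * (partialT φ τ x + c τ x * partialX φ τ x)

/-- `(u, v)` is an entropy solution on `[0,T] × ℝ` of the triangular system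
`u_t + f(u)_x = 0`, `v_t + (g(u) v)_x = 0` with initial value `(u₀, v₀)`. -/
structure IsTriangularEntropySolution (f g : ℝ → ℝ) (T : ℝ) (u₀ v₀ : ℝ → ℝ)
    (u v : ℝ → ℝ → ℝ) : Prop where
  entropy_u : IsEntropySolution f T u₀ u
  transport_v : IsWeakTransportSolution (fun t x => g (u t x)) T v₀ v

/-- `Y` is a characteristic on `[0,T]` of the velocity field `c`, starting at `x₀`:
`Y' = c(t, Y)`, `Y 0 = x₀` (one-sided derivatives at the ends of the interval). -/
def IsCharacteristic (c : ℝ → ℝ → ℝ) (T x₀ : ℝ) (Y : ℝ → ℝ) : Prop :=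
  Y 0 = x₀ ∧ ∀ t ∈ Set.Icc 0 T, HasDerivWithinAt Y (c t (Y t)) (Set.Icc 0 T) t

/-- `v` is obtained from `v₀` by the method of characteristics for `v_t + (c v)_x = 0`: from every
point of the line starts exactly one characteristic `X · x₀`, the maps `X t` are homeomorphisms of
the line, and `v t dx` is the image of `v₀ dx` under `X t`. -/
def IsObtainedByCharacteristics (c : ℝ → ℝ → ℝ) (T : ℝ) (v₀ : ℝ → ℝ) (v : ℝ → ℝ → ℝ) : Prop :=
  ∃ X : ℝ → ℝ → ℝ,
    (∀ x₀, IsCharacteristic c T x₀ (fun t => X t x₀)) ∧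
    (∀ x₀ Y, IsCharacteristic c T x₀ Y → ∀ t ∈ Set.Icc 0 T, Y t = X t x₀) ∧
    (∀ t ∈ Set.Icc 0 T, IsHomeomorph (X t)) ∧
    ∀ t ∈ Set.Icc 0 T, ∀ ψ : ℝ → ℝ, Continuous ψ → HasCompactSupport ψ →
      ∫ x : ℝ, v t x * ψ x = ∫ y : ℝ, v₀ y * ψ (X t y)

end

/-! Everything is built from the velocity `a = f'(u)`, which solves Burgers' equation and is
constant along the lines `x = y + t b(y)`, `b = f'(u₀)`. With `b` nonnegative, `C¹` and of Lipschitz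
constant `1/(2T)`, these lines do not cross up to time `T`; their flow is bi-Lipschitz and `u =
a^(1/p)` is continuous. As `u` need not be Lipschitz, the Kruzhkov relation is not checked
pointwise: in the coordinate `y` its integrand is a total `y`-derivative plus a `t`-derivative
(`classicalSolution_kruzhkov`).

The profile of `exists_profile` takes, at the points `1/log(πk)`, the value `0` for even `k` and
`2c/(k log³(πk))` for odd `k`. These amplitudes are summable, as they must be for a Lipschitz `b`,
but no power `q < 1` of them is. The `(1/p + ε)`-variation of `u` sums exactly such a power, with `q
= (1/p)/(1/p + ε)`, and the increasing flow carries the oscillation to every time `t`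
(`fracTV_eq_top_of_alternating`).

For `v`, the speed is `g(u) = h(a)`, which is Lipschitz in space because `a` is, even where `u` is
not. Hence it has a unique bi-Lipschitz flow `X`, and the image of `v₀ dx` has density `v₀(Y) ∂ₓY`,
where `Y = X⁻¹` and `∂ₓY` is bounded below by a positive constant. If `v₀` alternates between `1`
and `-1` on infinitely many intervals, `v` makes infinitely many jumps of size bounded below, so its
variation of every order is infinite (`fracTV_transportedDensity_eq_top`). -/

noncomputable section

/-! ### Bi-Lipschitz flows and changes of variables -/

/-- A family of maps `X t` of the line, uniformly expanding by at least `m > 0` and at most `M`, and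
`C`-Lipschitz in time. -/
structure IsBiLipschitzFlow (X : ℝ → ℝ → ℝ) (m M C : ℝ) : Prop where
  pos : 0 < m
  expand : ∀ t y z, y ≤ z → m * (z - y) ≤ X t z - X t y
  lip : ∀ t y z, y ≤ z → X t z - X t y ≤ M * (z - y)
  time : ∀ t s y, |X t y - X s y| ≤ C * |t - s|

/-- The inverse maps of a family of bijections. -/
def flowInv (X : ℝ → ℝ → ℝ) (t : ℝ) : ℝ → ℝ := Function.invFun (X t)

namespace IsBiLipschitzFlow

variable {X : ℝ → ℝ → ℝ} {m M C : ℝ}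

lemma strictMono (H : IsBiLipschitzFlow X m M C) (t : ℝ) : StrictMono (X t) := fun y z hyz => by
  have := H.expand t y z hyz.le
  have := mul_pos H.pos (sub_pos.2 hyz)
  linarith

lemma le_M (H : IsBiLipschitzFlow X m M C) : m ≤ M := by
  have h1 := H.expand 0 0 1 zero_le_one
  have h2 := H.lip 0 0 1 zero_le_one
  linarith

lemma abs_sub_le (H : IsBiLipschitzFlow X m M C) (t y z : ℝ) : |X t y - X t z| ≤ M * |y - z| := by
  wlog hyz : z ≤ y generalizing y z
  · rw [abs_sub_comm, abs_sub_comm y]; exact this z y (le_of_not_ge hyz)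
  rw [abs_of_nonneg (sub_nonneg.2 hyz), abs_of_nonneg (sub_nonneg.2 ((H.strictMono t).monotone hyz))]
  exact H.lip t z y hyz

lemma le_abs_sub (H : IsBiLipschitzFlow X m M C) (t y z : ℝ) : m * |y - z| ≤ |X t y - X t z| := by
  wlog hyz : z ≤ y generalizing y z
  · rw [abs_sub_comm, abs_sub_comm (X t y)]; exact this z y (le_of_not_ge hyz)
  rw [abs_of_nonneg (sub_nonneg.2 hyz), abs_of_nonneg (sub_nonneg.2 ((H.strictMono t).monotone hyz))]
  exact H.expand t z y hyz

lemma continuous_uncurry (H : IsBiLipschitzFlow X m M C) : Continuous (Function.uncurry X) := by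
  rw [continuous_iff_continuousAt]
  rintro ⟨t, y⟩
  rw [ContinuousAt, tendsto_iff_dist_tendsto_zero]
  have key : Tendsto (fun q : ℝ × ℝ => C * |q.1 - t| + M * |q.2 - y|) (𝓝 (t, y)) (𝓝 0) := by
    have : Continuous fun q : ℝ × ℝ => C * |q.1 - t| + M * |q.2 - y| := by fun_prop
    simpa using this.tendsto (t, y)
  refine squeeze_zero (fun _ => dist_nonneg) (fun q => ?_) key
  calc dist (X q.1 q.2) (X t y) ≤ dist (X q.1 q.2) (X t q.2) + dist (X t q.2) (X t y) :=
        dist_triangle _ _ _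
    _ ≤ _ := add_le_add (H.time _ _ _) (H.abs_sub_le _ _ _)

lemma continuous (H : IsBiLipschitzFlow X m M C) (t : ℝ) : Continuous (X t) :=
  H.continuous_uncurry.comp (by fun_prop : Continuous fun y : ℝ => (t, y))

lemma surjective (H : IsBiLipschitzFlow X m M C) (t : ℝ) : Function.Surjective (X t) := by
  refine (H.continuous t).surjective ?_ ?_
  · refine tendsto_atTop_mono' atTop (f₁ := fun y => X t 0 + m * y) ?_ ?_
    · filter_upwards [eventually_ge_atTop 0] with y hy
      have := H.expand t 0 y hy
      simp only [sub_zero] at this; linarith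
    · exact tendsto_atTop_add_const_left _ _ (tendsto_id.const_mul_atTop H.pos)
  · refine tendsto_atBot_mono' atBot (f₁ := fun y => X t 0 + m * y) ?_ ?_
    · filter_upwards [eventually_le_atBot 0] with y hy
      have := H.expand t y 0 hy
      simp only [zero_sub] at this; linarith
    · exact tendsto_atBot_add_const_left _ _ (tendsto_id.const_mul_atBot H.pos)

lemma right_inv (H : IsBiLipschitzFlow X m M C) (t x : ℝ) : X t (flowInv X t x) = x :=
  Function.rightInverse_invFun (H.surjective t) x

lemma left_inv (H : IsBiLipschitzFlow X m M C) (t y : ℝ) : flowInv X t (X t y) = y :=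
  Function.leftInverse_invFun (H.strictMono t).injective y

lemma isHomeomorph (H : IsBiLipschitzFlow X m M C) (t : ℝ) : IsHomeomorph (X t) := by
  have := ((H.strictMono t).orderIsoOfSurjective _ (H.surjective t)).toHomeomorph.isHomeomorph
  exact this

lemma inv_expand (H : IsBiLipschitzFlow X m M C) (t x x' : ℝ) (h : x ≤ x') :
    M⁻¹ * (x' - x) ≤ flowInv X t x' - flowInv X t x := by
  have hM : 0 < M := H.pos.trans_le H.le_M
  have hle : flowInv X t x ≤ flowInv X t x' := by
    rw [← (H.strictMono t).le_iff_le, H.right_inv, H.right_inv]; exact h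
  have := H.lip t _ _ hle
  rw [H.right_inv, H.right_inv] at this
  rwa [inv_mul_le_iff₀ hM]

lemma inv_lip (H : IsBiLipschitzFlow X m M C) (t x x' : ℝ) (h : x ≤ x') :
    flowInv X t x' - flowInv X t x ≤ m⁻¹ * (x' - x) := by
  have hle : flowInv X t x ≤ flowInv X t x' := by
    rw [← (H.strictMono t).le_iff_le, H.right_inv, H.right_inv]; exact h
  have := H.expand t _ _ hle
  rw [H.right_inv, H.right_inv] at this
  rwa [le_inv_mul_iff₀ H.pos]

lemma inv_time (H : IsBiLipschitzFlow X m M C) (t s x : ℝ) :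
    |flowInv X t x - flowInv X s x| ≤ (m⁻¹ * C) * |t - s| := by
  have h1 := H.le_abs_sub t (flowInv X t x) (flowInv X s x)
  have h2 := H.time s t (flowInv X s x)
  rw [H.right_inv] at h1 h2
  rw [mul_assoc, le_inv_mul_iff₀ H.pos, abs_sub_comm t]
  exact h1.trans h2

/-- The class is closed under inversion, so joint continuity and the derivative bounds for `X` serve
for the inverse maps as well. -/
lemma inv (H : IsBiLipschitzFlow X m M C) :
    IsBiLipschitzFlow (flowInv X) M⁻¹ m⁻¹ (m⁻¹ * C) :=
  ⟨inv_pos.2 (H.pos.trans_le H.le_M), H.inv_expand, H.inv_lip, H.inv_time⟩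

lemma lipschitzWith (H : IsBiLipschitzFlow X m M C) (t : ℝ) :
    LipschitzWith ⟨M, (H.pos.trans_le H.le_M).le⟩ (X t) :=
  LipschitzWith.of_dist_le_mul fun y z => H.abs_sub_le t y z

lemma abs_deriv_le (H : IsBiLipschitzFlow X m M C) (t y : ℝ) : |deriv (X t) y| ≤ M :=
  norm_deriv_le_of_lipschitz (H.lipschitzWith t)

lemma le_deriv (H : IsBiLipschitzFlow X m M C) {t y : ℝ} (hd : DifferentiableAt ℝ (X t) y) :
    m ≤ deriv (X t) y := by
  have hs := (hasDerivAt_iff_tendsto_slope.1 hd.hasDerivAt)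
  refine ge_of_tendsto hs ?_
  filter_upwards [self_mem_nhdsWithin] with z hz
  rcases lt_or_gt_of_ne (show z ≠ y from hz) with h | h
  · rw [slope_comm, slope_def_field, le_div_iff₀ (sub_pos.2 h)]; exact H.expand t _ _ h.le
  · rw [slope_def_field, le_div_iff₀ (sub_pos.2 h)]; exact H.expand t _ _ h.le

/-- The density `v₀ (Y t x) * ∂ₓ Y t x`, with `Y t = (X t)⁻¹`, is the density of the image of
`v₀ dx` under `X t`. -/
lemma integral_pushforward (H : IsBiLipschitzFlow X m M C) (t : ℝ) (v₀ ψ : ℝ → ℝ) :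
    ∫ x, (v₀ (flowInv X t x) * deriv (flowInv X t) x) * ψ x = ∫ y, v₀ y * ψ (X t y) := by
  set Y := flowInv X t with hY
  have HI := H.inv
  set s := {x | DifferentiableAt ℝ Y x} with hs
  have hsm : MeasurableSet s := measurableSet_of_differentiableAt ℝ Y
  have hae : ∀ᵐ x, x ∈ s := (HI.lipschitzWith t).ae_differentiableAt_real
  -- `Y` is onto, so the points missed by `Y '' s` lie in `Y '' sᶜ`, the Lipschitz image of a null
  -- set. The area formula on `s` then gives the formula on the whole line.
  have himg : ∀ᵐ y, y ∈ Y '' s := by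
    have h0 : volume (Y '' sᶜ) = 0 := by
      have h1 := (HI.lipschitzWith t).hausdorffMeasure_image_le (d := 1) zero_le_one sᶜ
      rw [hausdorffMeasure_real] at h1
      have h2 : volume sᶜ = 0 := hae
      rw [h2, mul_zero] at h1
      exact le_antisymm h1 (zero_le)
    refine measure_mono_null (fun y hy => ?_) h0
    refine ⟨X t y, fun hmem => hy ⟨X t y, hmem, H.left_inv t y⟩, H.left_inv t y⟩
  have key := integral_image_eq_integral_abs_deriv_smul hsm
    (fun x (hx : DifferentiableAt ℝ Y x) => hx.hasDerivAt.hasDerivWithinAt)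
    ((HI.strictMono t).injective.injOn) (fun y => v₀ y * ψ (X t y))
  have e1 : volume.restrict (Y '' s) = volume :=
    Measure.restrict_eq_self_of_ae_mem himg
  have e2 : volume.restrict s = volume := Measure.restrict_eq_self_of_ae_mem hae
  rw [e1, e2] at key
  rw [key]
  refine integral_congr_ae ?_
  filter_upwards [hae] with x hx
  have hpos : 0 ≤ deriv Y x := HI.pos.le.trans (HI.le_deriv hx)
  rw [H.right_inv, abs_of_nonneg hpos, smul_eq_mul]
  ring

end IsBiLipschitzFlow

/-- Fubini's theorem for a continuous integrand that is compactly supported in space on a bounded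
time interval, with a bounded measurable weight. -/
lemma integral_weight_mul_swap {w : ℝ → ℝ} {B R a c : ℝ} (hw : Measurable w) (hB : ∀ y, |w y| ≤ B)
    {H : ℝ × ℝ → ℝ} (hH : Continuous H)
    (hR : ∀ t ∈ Set.uIoc a c, ∀ y, R < |y| → w y * H (t, y) = 0) :
    ∫ t in a..c, ∫ y, w y * H (t, y) = ∫ y, w y * ∫ t in a..c, H (t, y) := by
  rw [intervalIntegral_integral_swap]
  · simp only [intervalIntegral.integral_const_mul]
  · have hI : IntegrableOn H (Set.uIcc a c ×ˢ Set.Icc (-R) R) (volume.prod volume) :=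
      hH.continuousOn.integrableOn_compact (isCompact_uIcc.prod isCompact_Icc)
    have hI2 : IntegrableOn (fun q : ℝ × ℝ => w q.2 * H q) (Set.uIoc a c ×ˢ Set.Icc (-R) R)
        (volume.prod volume) :=
      (hI.mono_set (Set.prod_mono Set.uIoc_subset_uIcc le_rfl)).bdd_mul
        (hw.comp measurable_snd).aestronglyMeasurable (Eventually.of_forall fun q => hB q.2)
    have hI3 : IntegrableOn (fun q : ℝ × ℝ => w q.2 * H q) (Set.uIoc a c ×ˢ Set.univ)
        (volume.prod volume) := by
      refine hI2.of_forall_sdiff_eq_zero (measurableSet_uIoc.prod MeasurableSet.univ) ?_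
      rintro ⟨t, y⟩ ⟨⟨ht, -⟩, hn⟩
      refine hR t ht y ?_
      by_contra hle
      exact hn ⟨ht, abs_le.1 (not_lt.1 hle)⟩
    rw [IntegrableOn, ← Measure.prod_restrict, Measure.restrict_univ] at hI3
    exact hI3

/-! ### Characteristics of velocity fields Lipschitz in space -/

/-- The projection of the real line onto `[0, T]`. -/
def clampTime (T t : ℝ) : ℝ := max 0 (min t T)

lemma clampTime_mem {T : ℝ} (hT : 0 ≤ T) (t : ℝ) : clampTime T t ∈ Set.Icc 0 T :=
  ⟨le_max_left _ _, max_le hT (min_le_right _ _)⟩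

lemma clampTime_of_mem {T t : ℝ} (ht : t ∈ Set.Icc 0 T) : clampTime T t = t := by
  rw [clampTime, min_eq_left ht.2, max_eq_right ht.1]

lemma abs_clampTime_sub_le (T t s : ℝ) : |clampTime T t - clampTime T s| ≤ |t - s| := by
  unfold clampTime
  have h1 := abs_max_sub_max_le_max 0 (min t T) 0 (min s T)
  have h2 := abs_min_sub_min_le_max t T s T
  rw [sub_self, abs_zero, max_eq_left (abs_nonneg (t - s))] at h2
  rw [sub_self, abs_zero, max_eq_right (abs_nonneg (min t T - min s T))] at h1
  exact h1.trans h2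

/-- Two characteristics of a velocity field that is `K`-Lipschitz in space separate and approach
each other at most exponentially. -/
lemma IsCharacteristic.abs_sub_bounds {c : ℝ → ℝ → ℝ} {T K y z : ℝ} {Y Z : ℝ → ℝ}
    (hc : ∀ t x x', |c t x - c t x'| ≤ K * |x - x'|)
    (hY : IsCharacteristic c T y Y) (hZ : IsCharacteristic c T z Z) {t : ℝ}
    (ht : t ∈ Set.Icc 0 T) :
    Real.exp (-(K * t)) * |y - z| ≤ |Y t - Z t| ∧ |Y t - Z t| ≤ Real.exp (K * t) * |y - z| := by
  have hD : ∀ s ∈ Set.Icc 0 T,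
      HasDerivWithinAt (fun s => Y s - Z s) (c s (Y s) - c s (Z s)) (Set.Icc 0 T) s :=
    fun s hs => (hY.2 s hs).sub (hZ.2 s hs)
  -- Grönwall for the squared distance, which is differentiable where `|Y - Z|` may not be; the
  -- weights `a = 2K` and `a = -2K` make it increasing and decreasing respectively.
  have hE : ∀ a : ℝ, ∀ s ∈ Set.Icc 0 T, HasDerivWithinAt
      (fun s => Real.exp (a * s) * (Y s - Z s) ^ 2)
      (Real.exp (a * s) * (a * (Y s - Z s) ^ 2
        + 2 * (Y s - Z s) * (c s (Y s) - c s (Z s)))) (Set.Icc 0 T) s := by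
    intro a s hs
    have h1 : HasDerivWithinAt (fun s => Real.exp (a * s)) (Real.exp (a * s) * (a * 1))
      (Set.Icc 0 T) s := (((hasDerivAt_id s).const_mul a).exp).hasDerivWithinAt
    have := h1.mul ((hD s hs).pow 2)
    convert! this using 1
    simp; ring
  have hbd : ∀ s, |2 * (Y s - Z s) * (c s (Y s) - c s (Z s))| ≤ 2 * K * (Y s - Z s) ^ 2 := by
    intro s
    rw [abs_mul, abs_mul, abs_two, ← sq_abs (Y s - Z s)]
    have := mul_le_mul_of_nonneg_left (hc s (Y s) (Z s)) (abs_nonneg (Y s - Z s))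
    nlinarith
  have h0 : (0 : ℝ) ∈ Set.Icc 0 T := ⟨le_rfl, ht.1.trans ht.2⟩
  have hmono : MonotoneOn (fun s => Real.exp (2 * K * s) * (Y s - Z s) ^ 2) (Set.Icc 0 T) := by
    refine monotoneOn_of_hasDerivWithinAt_nonneg (convex_Icc 0 T)
      (fun s hs => (hE _ s hs).continuousWithinAt)
      (fun s hs => (hE _ s (interior_subset hs)).mono interior_subset) fun s _ => ?_
    have := (abs_le.1 (hbd s)).1
    exact mul_nonneg (Real.exp_pos _).le (by linarith)
  have hanti : AntitoneOn (fun s => Real.exp (-(2 * K) * s) * (Y s - Z s) ^ 2) (Set.Icc 0 T) := by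
    refine antitoneOn_of_hasDerivWithinAt_nonpos (convex_Icc 0 T)
      (fun s hs => (hE _ s hs).continuousWithinAt)
      (fun s hs => (hE _ s (interior_subset hs)).mono interior_subset) fun s _ => ?_
    have := (abs_le.1 (hbd s)).2
    exact mul_nonpos_of_nonneg_of_nonpos (Real.exp_pos _).le (by linarith)
  have e1 := hmono h0 ht ht.1
  have e2 := hanti h0 ht ht.1
  simp only [mul_zero, Real.exp_zero, one_mul, hY.1, hZ.1] at e1 e2
  have x1 : Real.exp (2 * K * t) = Real.exp (K * t) ^ 2 := by
    rw [← Real.exp_nat_mul]; congr 1; push_cast; ring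
  have x2 : Real.exp (-(2 * K) * t) = Real.exp (-(K * t)) ^ 2 := by
    rw [← Real.exp_nat_mul]; congr 1; push_cast; ring
  have hx : Real.exp (-(K * t)) * Real.exp (K * t) = 1 := by rw [← Real.exp_add]; simp
  rw [x1, ← mul_pow] at e1
  rw [x2, ← mul_pow] at e2
  have e1' := sq_le_sq.1 e1
  have e2' := sq_le_sq.1 e2
  rw [abs_mul, Real.abs_exp] at e1' e2'
  constructor
  · calc _ ≤ Real.exp (-(K * t)) * (Real.exp (K * t) * |Y t - Z t|) := by gcongr
      _ = _ := by rw [← mul_assoc, hx, one_mul]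
  · calc |Y t - Z t| = Real.exp (K * t) * (Real.exp (-(K * t)) * |Y t - Z t|) := by
          rw [← mul_assoc, mul_comm (Real.exp (K * t)), hx, one_mul]
      _ ≤ _ := by gcongr

/-- A bounded continuous velocity field that is Lipschitz in space has characteristics on `[0, T]`
from every point. -/
lemma exists_isCharacteristic {c : ℝ → ℝ → ℝ} {T K M : ℝ} (hT : 0 ≤ T) (hK : 0 ≤ K) (hM : 0 ≤ M)
    (hc : ∀ t x x', |c t x - c t x'| ≤ K * |x - x'|) (hcont : ∀ x, Continuous fun t => c t x)
    (hcM : ∀ t x, |c t x| ≤ M) (y : ℝ) : ∃ Y, IsCharacteristic c T y Y := by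
  -- At speed at most `M` a solution stays in the ball of radius `M * T` up to time `T`, so the
  -- local theorem already covers the whole interval.
  have hpl : IsPicardLindelof c (tmin := 0) (tmax := T) ⟨0, le_rfl, hT⟩ y
      ⟨M * T, mul_nonneg hM hT⟩ 0 ⟨M, hM⟩ ⟨K, hK⟩ :=
    { lipschitzOnWith := fun t _ =>
        (LipschitzWith.of_dist_le_mul fun x x' => hc t x x').lipschitzOnWith
      continuousOn := fun x _ => (hcont x).continuousOn
      norm_le := fun t _ x _ => hcM t x
      mul_max_le := by
        simp only [sub_zero, sub_self, max_eq_left hT, NNReal.coe_zero]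
        exact le_refl (M * T) }
  exact hpl.exists_eq_forall_mem_Icc_hasDerivWithinAt₀

/-- The flow of a bounded continuous velocity field that is Lipschitz in space, frozen outside
`[0, T]`. -/
lemma exists_flow {c : ℝ → ℝ → ℝ} {T K M : ℝ} (hT : 0 ≤ T) (hK : 0 ≤ K) (hM : 0 ≤ M)
    (hc : ∀ t x x', |c t x - c t x'| ≤ K * |x - x'|) (hcont : ∀ x, Continuous fun t => c t x)
    (hcM : ∀ t x, |c t x| ≤ M) :
    ∃ X : ℝ → ℝ → ℝ, IsBiLipschitzFlow X (Real.exp (-(K * T))) (Real.exp (K * T)) M ∧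
      ∀ y, IsCharacteristic c T y (fun t => X t y) := by
  choose Φ hΦ using exists_isCharacteristic (T := T) hT hK hM hc hcont hcM
  have hmem := clampTime_mem hT
  have hcontΦ : ∀ y, ContinuousOn (Φ y) (Set.Icc 0 T) := fun y t ht =>
    ((hΦ y).2 t ht).continuousWithinAt
  have hKt : ∀ t, K * clampTime T t ≤ K * T := fun t => mul_le_mul_of_nonneg_left (hmem t).2 hK
  -- If the order were reversed the two characteristics would meet, which the exponential lower
  -- bound on their distance forbids.
  have horder : ∀ y z, y ≤ z → ∀ t ∈ Set.Icc 0 T, Φ y t ≤ Φ z t := by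
    intro y z hyz t ht
    rcases hyz.eq_or_lt with rfl | hlt
    · exact le_rfl
    by_contra! hneg
    have hiv : (0 : ℝ) ∈ (fun s => Φ z s - Φ y s) '' Set.Icc 0 t := by
      refine intermediate_value_Icc' ht.1 (((hcontΦ z).sub (hcontΦ y)).mono
        (Set.Icc_subset_Icc_right ht.2)) ⟨(sub_neg.2 hneg).le, ?_⟩
      simp only [Pi.sub_apply, (hΦ z).1, (hΦ y).1]; linarith
    obtain ⟨s, hs, hs0⟩ := hiv
    have := ((hΦ z).abs_sub_bounds hc (hΦ y) ⟨hs.1, hs.2.trans ht.2⟩).1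
    simp only at hs0
    rw [hs0, abs_zero, abs_of_pos (sub_pos.2 hlt)] at this
    exact absurd this (not_le.2 (mul_pos (Real.exp_pos _) (sub_pos.2 hlt)))
  refine ⟨fun t y => Φ y (clampTime T t), ⟨Real.exp_pos _, ?_, ?_, ?_⟩, ?_⟩
  · intro t y z hyz
    have := ((hΦ z).abs_sub_bounds hc (hΦ y) (hmem t)).1
    rw [abs_of_nonneg (sub_nonneg.2 hyz),
      abs_of_nonneg (sub_nonneg.2 (horder y z hyz _ (hmem t)))] at this
    refine le_trans ?_ this
    refine mul_le_mul_of_nonneg_right (Real.exp_le_exp.2 (by linarith [hKt t])) (sub_nonneg.2 hyz)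
  · intro t y z hyz
    have := ((hΦ z).abs_sub_bounds hc (hΦ y) (hmem t)).2
    rw [abs_of_nonneg (sub_nonneg.2 hyz),
      abs_of_nonneg (sub_nonneg.2 (horder y z hyz _ (hmem t)))] at this
    refine this.trans ?_
    refine mul_le_mul_of_nonneg_right (Real.exp_le_exp.2 (hKt t)) (sub_nonneg.2 hyz)
  · intro t s y
    have := (convex_Icc 0 T).norm_image_sub_le_of_norm_hasDerivWithin_le (hΦ y).2
      (fun x _ => hcM x _) (hmem s) (hmem t)
    exact this.trans (mul_le_mul_of_nonneg_left (abs_clampTime_sub_le T t s) hM)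
  · intro y
    have h0 : clampTime T 0 = 0 := clampTime_of_mem ⟨le_rfl, hT⟩
    refine ⟨by simpa only [h0] using (hΦ y).1, fun t ht => ?_⟩
    simp only [clampTime_of_mem ht]
    exact ((hΦ y).2 t ht).congr (fun s hs => by rw [clampTime_of_mem hs])
      (by rw [clampTime_of_mem ht])

/-! ### Calculus of test functions -/

namespace IsTestFunction

variable {φ : ℝ × ℝ → ℝ}

lemma differentiable (hφ : IsTestFunction φ) : Differentiable ℝ φ :=
  hφ.smooth.differentiable (by simp)

lemma partialT_eq (hφ : IsTestFunction φ) (t x : ℝ) :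
    partialT φ t x = fderiv ℝ φ (t, x) (1, 0) := by
  have h1 : HasDerivAt (fun τ : ℝ => (τ, x)) ((1 : ℝ), (0 : ℝ)) t :=
    (hasDerivAt_id t).prodMk (hasDerivAt_const t x)
  exact ((hφ.differentiable (t, x)).hasFDerivAt.comp_hasDerivAt t h1).deriv

lemma partialX_eq (hφ : IsTestFunction φ) (t x : ℝ) :
    partialX φ t x = fderiv ℝ φ (t, x) (0, 1) := by
  have h1 : HasDerivAt (fun y : ℝ => (t, y)) ((0 : ℝ), (1 : ℝ)) x :=
    (hasDerivAt_const x t).prodMk (hasDerivAt_id x)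
  exact ((hφ.differentiable (t, x)).hasFDerivAt.comp_hasDerivAt x h1).deriv

lemma continuous_partialT (hφ : IsTestFunction φ) :
    Continuous fun q : ℝ × ℝ => partialT φ q.1 q.2 := by
  simp only [hφ.partialT_eq]
  exact (hφ.smooth.continuous_fderiv (by simp)).clm_apply continuous_const

lemma continuous_partialX (hφ : IsTestFunction φ) :
    Continuous fun q : ℝ × ℝ => partialX φ q.1 q.2 := by
  simp only [hφ.partialX_eq]
  exact (hφ.smooth.continuous_fderiv (by simp)).clm_apply continuous_const

lemma exists_radius (hφ : IsTestFunction φ) :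
    ∃ R, ∀ t x, R < |x| → φ (t, x) = 0 ∧ partialT φ t x = 0 ∧ partialX φ t x = 0 := by
  obtain ⟨R, hR⟩ := hφ.compact.isCompact.isBounded.subset_closedBall 0
  refine ⟨R, fun t x hx => ?_⟩
  have hn : (t, x) ∉ tsupport φ := fun hmem => by
    have := hR hmem
    rw [mem_closedBall_zero_iff] at this
    exact absurd ((norm_snd_le (t, x)).trans this) (not_le.2 hx)
  have hf : fderiv ℝ φ (t, x) = 0 := image_eq_zero_of_notMem_tsupport
    fun hmem => hn (tsupport_fderiv_subset ℝ hmem)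
  exact ⟨image_eq_zero_of_notMem_tsupport hn, by simp [hφ.partialT_eq, hf],
    by simp [hφ.partialX_eq, hf]⟩

lemma hasDerivWithinAt_along (hφ : IsTestFunction φ) {γ : ℝ → ℝ} {γ' t : ℝ} {s : Set ℝ}
    (hγ : HasDerivWithinAt γ γ' s t) :
    HasDerivWithinAt (fun τ => φ (τ, γ τ))
      (partialT φ t (γ t) + γ' * partialX φ t (γ t)) s t := by
  have h1 : HasDerivWithinAt (fun τ => (τ, γ τ)) ((1 : ℝ), γ') s t :=
    (hasDerivWithinAt_id t s).prodMk hγ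
  have h2 := (hφ.differentiable (t, γ t)).hasFDerivAt.comp_hasDerivWithinAt t h1
  convert! h2 using 1
  have : ((1 : ℝ), γ') = (1, 0) + γ' • ((0 : ℝ), (1 : ℝ)) := by simp
  rw [this, map_add, map_smul, hφ.partialT_eq, hφ.partialX_eq, smul_eq_mul]

lemma hasDerivAt_space (hφ : IsTestFunction φ) (t : ℝ) {γ : ℝ → ℝ} {γ' y : ℝ}
    (hγ : HasDerivAt γ γ' y) :
    HasDerivAt (fun z => φ (t, γ z)) (γ' * partialX φ t (γ y)) y := by
  have h1 : HasDerivAt (fun z => (t, γ z)) ((0 : ℝ), γ') y :=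
    (hasDerivAt_const y t).prodMk hγ
  have h2 := (hφ.differentiable (t, γ y)).hasFDerivAt.comp_hasDerivAt y h1
  convert! h2 using 1
  have : ((0 : ℝ), γ') = γ' • ((0 : ℝ), (1 : ℝ)) := by simp
  rw [this, map_smul, hφ.partialX_eq, smul_eq_mul]

end IsTestFunction

namespace IsBiLipschitzFlow

lemma flowInv_flowInv {X : ℝ → ℝ → ℝ} {m M C : ℝ} (H : IsBiLipschitzFlow X m M C) :
    flowInv (flowInv X) = X := by
  ext t y
  exact (H.inv.strictMono t).injective (by rw [H.inv.right_inv, H.left_inv])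

/-- This is `integral_pushforward` with the roles of `X` and its inverse exchanged. -/
lemma integral_comp_mul_deriv {X : ℝ → ℝ → ℝ} {m M C : ℝ} (H : IsBiLipschitzFlow X m M C)
    (t : ℝ) (w : ℝ → ℝ) : ∫ y, w (X t y) * deriv (X t) y = ∫ x, w x := by
  have := H.inv.integral_pushforward t w fun _ => 1
  simpa only [H.flowInv_flowInv, mul_one] using this

end IsBiLipschitzFlow

/-! ### Burgers flow and the Kruzhkov inequalities -/

/-- The flow of the Burgers equation `a_t + a a_x = 0` with initial value `b`, frozen outside
`[0, T]`. -/
def burgersFlow (T : ℝ) (b : ℝ → ℝ) (t y : ℝ) : ℝ := y + clampTime T t * b y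

/-- Since `L * T ≤ 1 / 2`, the term `t b(y)` perturbs the identity by a map of Lipschitz constant at
most `1/2`. -/
lemma isBiLipschitzFlow_burgersFlow {T L B : ℝ} {b : ℝ → ℝ} (hT : 0 ≤ T)
    (hb : ∀ y z, |b y - b z| ≤ L * |y - z|) (hLT : L * T ≤ 1 / 2) (hB : ∀ y, |b y| ≤ B) :
    IsBiLipschitzFlow (burgersFlow T b) (1 / 2) (3 / 2) B := by
  have key : ∀ t y z, y ≤ z → |clampTime T t * (b z - b y)| ≤ 1 / 2 * (z - y) := by
    intro t y z hyz
    have hm := clampTime_mem hT t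
    have h1 := hb z y
    rw [abs_of_nonneg (sub_nonneg.2 hyz)] at h1
    rw [abs_mul, abs_of_nonneg hm.1]
    calc clampTime T t * |b z - b y| ≤ T * (L * (z - y)) := by
          exact mul_le_mul hm.2 h1 (abs_nonneg _) hT
      _ = L * T * (z - y) := by ring
      _ ≤ _ := mul_le_mul_of_nonneg_right hLT (sub_nonneg.2 hyz)
  refine ⟨by norm_num, fun t y z hyz => ?_, fun t y z hyz => ?_, fun t s y => ?_⟩
  · have := (abs_le.1 (key t y z hyz)).1
    simp only [burgersFlow]; linarith
  · have := (abs_le.1 (key t y z hyz)).2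
    simp only [burgersFlow]; linarith
  · have : burgersFlow T b t y - burgersFlow T b s y
        = b y * (clampTime T t - clampTime T s) := by simp only [burgersFlow]; ring
    rw [this, abs_mul]
    exact mul_le_mul (hB y) (abs_clampTime_sub_le T t s) (abs_nonneg _)
      ((abs_nonneg _).trans (hB y))

/-- The Kruzhkov flux minus velocity times entropy, as a function of the velocity `a = f'(u)`. -/
def kruzhkovPotential (p k a : ℝ) : ℝ :=
  Real.sign (a ^ (1 / p) - k) * (k * a - p / (p + 1) * a ^ (1 + 1 / p) - powerFlux p k)

lemma powerFlux_rpow {p a : ℝ} (hp : 0 < p) (ha : 0 ≤ a) :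
    powerFlux p (a ^ (1 / p)) = a * a ^ (1 / p) / (p + 1) := by
  have hu : 0 ≤ a ^ (1 / p) := Real.rpow_nonneg ha _
  rw [powerFlux, abs_of_nonneg hu, Real.rpow_add_one' hu (by positivity), ← Real.rpow_mul ha,
    one_div_mul_cancel hp.ne', Real.rpow_one]

lemma kruzhkovPotential_eq {p k a : ℝ} (hp : 0 < p) (ha : 0 ≤ a) :
    kruzhkovPotential p k a = Real.sign (a ^ (1 / p) - k) *
      (powerFlux p (a ^ (1 / p)) - powerFlux p k) - a * |a ^ (1 / p) - k| := by
  have hs : |a ^ (1 / p) - k| = Real.sign (a ^ (1 / p) - k) * (a ^ (1 / p) - k) := by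
    rcases lt_trichotomy (a ^ (1 / p) - k) 0 with h | h | h
    · rw [Real.sign_of_neg h, abs_of_neg h]; ring
    · rw [h]; simp
    · rw [Real.sign_of_pos h, abs_of_pos h]; ring
  have h1 : a ^ (1 + 1 / p) = a * a ^ (1 / p) := Real.rpow_one_add' ha (by positivity)
  rw [hs, powerFlux_rpow hp ha, kruzhkovPotential, h1]
  field_simp
  ring

/-- With entropy `η = |u - k|` and flux `Q`, the relation `dQ = a dη` gives `d(Q - aη) = -η da`:
neither the kink of `η` nor the root in `u = a^(1/p)` destroys differentiability in `a`. -/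
lemma hasDerivAt_kruzhkovPotential {p k a : ℝ} (hp : 0 < p) (ha : 0 ≤ a) :
    HasDerivAt (kruzhkovPotential p k) (-|a ^ (1 / p) - k|) a := by
  set E : ℝ → ℝ := fun a => k * a - p / (p + 1) * a ^ (1 + 1 / p) - powerFlux p k with hE
  have hE' : HasDerivAt E (k - a ^ (1 / p)) a := by
    have h1 := Real.hasDerivAt_rpow_const (x := a) (p := 1 + 1 / p)
      (Or.inr (by linarith [one_div_pos.2 hp]))
    have h2 := (((hasDerivAt_id a).const_mul k).sub (h1.const_mul (p / (p + 1)))).sub_const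
      (powerFlux p k)
    convert! h2 using 1
    rw [add_sub_cancel_left]
    field_simp
  have hc : ContinuousAt (fun a : ℝ => a ^ (1 / p) - k) a :=
    (Real.continuousAt_rpow_const a (1 / p) (Or.inr (one_div_pos.2 hp).le)).sub
      continuousAt_const
  rcases lt_trichotomy (a ^ (1 / p) - k) 0 with h | h | h
  · rw [abs_of_neg h]
    refine (hE'.const_mul (-1)).congr_of_eventuallyEq ?_ |>.congr_deriv (by ring)
    filter_upwards [hc.eventually_lt continuousAt_const h] with x hx
    rw [kruzhkovPotential, Real.sign_of_neg hx]
  · have hk : a ^ (1 / p) = k := by linarith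
    have hE0 : E a = 0 := by
      have h1 : a ^ (1 + 1 / p) = a * a ^ (1 / p) := Real.rpow_one_add' ha (by positivity)
      simp only [hE]
      rw [← hk, powerFlux_rpow hp ha, h1]
      field_simp
      ring
    rw [h, abs_zero, neg_zero]
    rw [hk, sub_self] at hE'
    rw [hasDerivAt_iff_isLittleO] at hE' ⊢
    refine Asymptotics.IsBigO.trans_isLittleO (Asymptotics.IsBigO.of_bound 1 ?_) hE'
    refine Eventually.of_forall fun x => ?_
    have h2 : kruzhkovPotential p k a = 0 := by rw [kruzhkovPotential, h, Real.sign_zero, zero_mul]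
    rw [h2, hE0]
    simp only [smul_zero, sub_zero, one_mul, Real.norm_eq_abs, kruzhkovPotential, abs_mul]
    refine mul_le_of_le_one_left (abs_nonneg _) ?_
    rcases Real.sign_apply_eq (x ^ (1 / p) - k) with h | h | h <;> rw [h] <;> simp
  · rw [abs_of_pos h]
    refine (hE'.const_mul 1).congr_of_eventuallyEq ?_ |>.congr_deriv (by ring)
    filter_upwards [continuousAt_const.eventually_lt hc h] with x hx
    rw [kruzhkovPotential, Real.sign_of_pos hx]

lemma integrable_of_continuous_of_radius {w : ℝ → ℝ} {R : ℝ} (hw : Continuous w)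
    (hR : ∀ y, R < |y| → w y = 0) : Integrable w :=
  hw.integrable_of_hasCompactSupport (HasCompactSupport.intro (isCompact_Icc (a := -R) (b := R))
    fun y hy => hR y (not_le.1 fun h => hy (abs_le.1 h)))

/-- The function of `t, x` that equals `b (y) ^ (1/p)` along the line `x = y + t b(y)`. -/
def classicalSolution (T p : ℝ) (b : ℝ → ℝ) (t x : ℝ) : ℝ :=
  b (flowInv (burgersFlow T b) t x) ^ (1 / p)

/-- Before the crossing of characteristics the solution given by characteristics satisfies the
Kruzhkov inequalities, in fact with equality. -/
theorem classicalSolution_kruzhkov {T p L B : ℝ} {b : ℝ → ℝ} (hT : 0 ≤ T) (hp : 0 < p)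
    (hb1 : ContDiff ℝ 1 b) (hb0 : ∀ y, 0 ≤ b y)
    (hb : ∀ y z, |b y - b z| ≤ L * |y - z|) (hLT : L * T ≤ 1 / 2) (hB : ∀ y, |b y| ≤ B)
    (k : ℝ) {φ : ℝ × ℝ → ℝ} (hφ : IsTestFunction φ) (hφT : ∀ x, φ (T, x) = 0) :
    (∫ t in (0 : ℝ)..T, ∫ x : ℝ,
          (|classicalSolution T p b t x - k| * partialT φ t x
            + Real.sign (classicalSolution T p b t x - k) *
              (powerFlux p (classicalSolution T p b t x) - powerFlux p k) * partialX φ t x))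
        + ∫ x : ℝ, |b x ^ (1 / p) - k| * φ (0, x) = 0 := by
  have H := isBiLipschitzFlow_burgersFlow hT hb hLT hB
  obtain ⟨R, hR⟩ := hφ.exists_radius
  have hbc : Continuous b := hb1.continuous
  have hb'c : Continuous (deriv b) := hb1.continuous_deriv le_rfl
  have hbd : ∀ y, HasDerivAt b (deriv b y) y := fun y =>
    (hb1.differentiable (by simp) y).hasDerivAt
  set F : ℝ → ℝ := fun y => |b y ^ (1 / p) - k| with hF
  have hFc : Continuous F :=
    ((hbc.rpow_const fun _ => Or.inr (one_div_pos.2 hp).le).sub continuous_const).abs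
  set G : ℝ → ℝ := fun y => kruzhkovPotential p k (b y) with hG
  have hGd : ∀ y, HasDerivAt G (-F y * deriv b y) y := fun y =>
    (hasDerivAt_kruzhkovPotential hp (hb0 y)).comp y (hbd y)
  have hGc : Continuous G := continuous_iff_continuousAt.2 fun y => (hGd y).continuousAt
  have hφc := hφ.smooth.continuous
  have hφt := hφ.continuous_partialT
  have hφx := hφ.continuous_partialX
  -- The time derivative of `(1 + t b'(y)) φ(t, y + t b(y))`, the test function times the Jacobian
  -- of the flow.
  set S : ℝ → ℝ → ℝ := fun t y =>
    deriv b y * φ (t, y + t * b y) + (1 + t * deriv b y) *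
      (partialT φ t (y + t * b y) + b y * partialX φ t (y + t * b y)) with hS
  have hSc : Continuous fun q : ℝ × ℝ => S q.1 q.2 := by
    have e : Continuous fun q : ℝ × ℝ => (q.1, q.2 + q.1 * b q.2) := by fun_prop
    have := hφt.comp e
    have := hφx.comp e
    simp only [Function.comp_def] at *
    simp only [hS]
    fun_prop
  have hfar : ∀ t ∈ Set.Icc 0 T, ∀ y, R + T * B < |y| → R < |y + t * b y| := by
    intro t ht y hy
    have h1 : |t * b y| ≤ T * B := by
      rw [abs_mul, abs_of_nonneg ht.1]
      exact mul_le_mul ht.2 (hB y) (abs_nonneg _) hT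
    have h2 := abs_sub_abs_le_abs_sub y (-(t * b y))
    rw [abs_neg, sub_neg_eq_add] at h2
    linarith
  have hS0 : ∀ t ∈ Set.Icc 0 T, ∀ y, R + T * B < |y| → S t y = 0 := by
    intro t ht y hy
    obtain ⟨h1, h2, h3⟩ := hR t _ (hfar t ht y hy)
    simp [hS, h1, h2, h3]
  have hslice : ∀ t ∈ Set.Icc 0 T, (∫ x : ℝ,
          (|classicalSolution T p b t x - k| * partialT φ t x
            + Real.sign (classicalSolution T p b t x - k) *
              (powerFlux p (classicalSolution T p b t x) - powerFlux p k) * partialX φ t x))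
        = ∫ y, F y * S t y := by
    intro t ht
    rw [← H.integral_comp_mul_deriv t]
    have hXt : burgersFlow T b t = fun y => y + t * b y := by
      ext y; rw [burgersFlow, clampTime_of_mem ht]
    have hXd : ∀ y, HasDerivAt (fun y => y + t * b y) (1 + t * deriv b y) y := fun y =>
      (hasDerivAt_id y).add ((hbd y).const_mul t)
    have hcl : ∀ y, classicalSolution T p b t (y + t * b y) = b y ^ (1 / p) := by
      intro y
      have := H.left_inv t y
      rw [hXt] at this
      rw [classicalSolution, this]
    have hint1 : Integrable fun y => F y * S t y := by
      refine integrable_of_continuous_of_radius (R := R + T * B)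
        (hFc.mul (hSc.comp (by fun_prop : Continuous fun y : ℝ => (t, y)))) fun y hy => ?_
      rw [hS0 t ht y hy, mul_zero]
    -- After the change of variables the integrand is `F * S` plus this exact derivative, whose
    -- integral is zero by compact support.
    have hprod : ∀ y, HasDerivAt (fun y => G y * φ (t, y + t * b y))
        (-F y * deriv b y * φ (t, y + t * b y)
          + G y * ((1 + t * deriv b y) * partialX φ t (y + t * b y))) y := fun y =>
      (hGd y).mul (hφ.hasDerivAt_space t (hXd y))
    have e : Continuous fun y : ℝ => (t, y + t * b y) := by fun_prop
    have c1 : Continuous fun y => φ (t, y + t * b y) := hφc.comp e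
    have c2 : Continuous fun y => partialX φ t (y + t * b y) := hφx.comp e
    have hint2 : Integrable fun y => -F y * deriv b y * φ (t, y + t * b y)
          + G y * ((1 + t * deriv b y) * partialX φ t (y + t * b y)) := by
      refine integrable_of_continuous_of_radius (R := R + T * B) (by fun_prop) fun y hy => ?_
      obtain ⟨h1, h2, h3⟩ := hR t _ (hfar t ht y hy)
      simp [h1, h3]
    have hint3 : Integrable fun y => G y * φ (t, y + t * b y) := by
      refine integrable_of_continuous_of_radius (R := R + T * B) (by fun_prop) fun y hy => ?_
      obtain ⟨h1, h2, h3⟩ := hR t _ (hfar t ht y hy)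
      rw [h1, mul_zero]
    have hz := integral_eq_zero_of_hasDerivAt_of_integrable hprod hint2 hint3
    have hsum := integral_add hint1 hint2
    rw [hz, add_zero] at hsum
    rw [← hsum]
    refine integral_congr_ae (Eventually.of_forall fun y => ?_)
    simp only [hXt, (hXd y).deriv, hcl, hS, hG, hF]
    rw [kruzhkovPotential_eq hp (hb0 y)]
    ring
  have hI : (∫ t in (0 : ℝ)..T, ∫ y, 1 * (F y * S t y))
      = ∫ y, 1 * ∫ t in (0 : ℝ)..T, F y * S t y := by
    refine integral_weight_mul_swap (w := fun _ => 1) (B := 1) (R := R + T * B)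
      (H := fun q => F q.2 * S q.1 q.2) measurable_const
      (by simp) (by fun_prop) fun t ht y hy => ?_
    rw [Set.uIoc_of_le hT] at ht
    simp [hS0 t ⟨ht.1.le, ht.2⟩ y hy]
  have htime : ∀ y, ∫ t in (0 : ℝ)..T, F y * S t y = -(F y * φ (0, y)) := by
    intro y
    have hd : ∀ t, HasDerivAt (fun t => (1 + t * deriv b y) * φ (t, y + t * b y)) (S t y) t := by
      intro t
      have h1 : HasDerivAt (fun t : ℝ => y + t * b y) (b y) t := by
        simpa using ((hasDerivAt_id t).mul_const (b y)).const_add y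
      have h2 : HasDerivAt (fun t : ℝ => 1 + t * deriv b y) (deriv b y) t := by
        simpa using ((hasDerivAt_id t).mul_const (deriv b y)).const_add 1
      have h3 := hφ.hasDerivWithinAt_along (s := Set.univ) h1.hasDerivWithinAt
      rw [hasDerivWithinAt_univ] at h3
      exact h2.mul h3
    have hcy : Continuous fun t => S t y := hSc.comp (by fun_prop : Continuous fun t : ℝ => (t, y))
    rw [intervalIntegral.integral_const_mul,
      intervalIntegral.integral_eq_sub_of_hasDerivAt (fun t _ => hd t)
        (hcy.intervalIntegrable _ _), hφT]
    simp
  have hstart : (∫ t in (0 : ℝ)..T, ∫ x : ℝ,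
          (|classicalSolution T p b t x - k| * partialT φ t x
            + Real.sign (classicalSolution T p b t x - k) *
              (powerFlux p (classicalSolution T p b t x) - powerFlux p k) * partialX φ t x))
      = -∫ y, F y * φ (0, y) := by
    rw [← integral_neg]
    simp only [one_mul, htime] at hI
    rw [← hI]
    refine intervalIntegral.integral_congr fun t ht => ?_
    rw [Set.uIcc_of_le hT] at ht
    exact hslice t ht
  rw [hstart]
  exact neg_add_cancel _

/-! ### Lower bounds for the fractional variation -/

/-- The oscillation points accumulate from the right and are naturally listed in decreasing order;
reversing the indices yields a subdivision. -/
lemma sum_le_fracTV (s : ℝ) (w : ℝ → ℝ) {n : ℕ} {x : ℕ → ℝ} (hx : ∀ i < n, x (i + 1) < x i) :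
    ∑ i ∈ Finset.range n, ENNReal.ofReal (|w (x (i + 1)) - w (x i)| ^ (1 / s)) ≤ fracTV s w := by
  have hmono : StrictMonoOn (fun j => x (n - j)) (Set.Iic n) := by
    refine strictMonoOn_Iic_of_lt_succ fun j hj => ?_
    have := hx (n - (j + 1)) (by omega)
    rwa [show n - (j + 1) + 1 = n - j by omega] at this
  refine le_trans (le_of_eq ?_) (le_iSup₂_of_le n (fun j => x (n - j)) (le_iSup_of_le hmono le_rfl))
  rw [← Finset.sum_range_reflect]
  refine Finset.sum_congr rfl fun j hj => ?_
  have hj := Finset.mem_range.1 hj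
  rw [show n - 1 - j + 1 = n - j by omega, show n - 1 - j = n - (j + 1) by omega, abs_sub_comm]

/-- The variation of a continuous function bounds from below that of all its representatives. -/
lemma sum_le_fracTV_of_ae_eq {s : ℝ} (hs : 0 < s) {u w : ℝ → ℝ} (hu : Continuous u)
    (hw : w =ᵐ[volume] u) {n : ℕ} {x : ℕ → ℝ} (hx : ∀ i < n, x (i + 1) < x i) :
    ∑ i ∈ Finset.range n, ENNReal.ofReal (|u (x (i + 1)) - u (x i)| ^ (1 / s)) ≤ fracTV s w := by
  -- The points of agreement are dense, so each node is a limit of such points; the order of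
  -- finitely many nodes is eventually preserved and `u` is continuous.
  have hd : Dense {y | w y = u y} := Measure.dense_of_ae hw
  choose z hz hzx using fun i => mem_closure_iff_seq_limit.1 (hd (x i))
  have hev : ∀ᶠ k in atTop, ∀ i < n, z (i + 1) k < z i k :=
    (Set.finite_lt_nat n).eventually_all.2 fun i hi => (hzx (i + 1)).eventually_lt (hzx i) (hx i hi)
  have hlim : Tendsto (fun k => ∑ i ∈ Finset.range n,
      ENNReal.ofReal (|u (z (i + 1) k) - u (z i k)| ^ (1 / s))) atTop
      (𝓝 (∑ i ∈ Finset.range n, ENNReal.ofReal (|u (x (i + 1)) - u (x i)| ^ (1 / s)))) := by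
    refine tendsto_finsetSum _ fun i _ => (ENNReal.continuous_ofReal.tendsto _).comp ?_
    refine Tendsto.rpow_const ?_ (Or.inr (one_div_pos.2 hs).le)
    exact (((hu.tendsto _).comp (hzx (i + 1))).sub ((hu.tendsto _).comp (hzx i))).abs
  refine le_of_tendsto hlim ?_
  filter_upwards [hev] with k hk
  have := sum_le_fracTV s w (x := fun i => z i k) hk
  simpa only [show ∀ i, w (z i k) = u (z i k) from fun i => hz i k] using this

lemma eq_top_of_sum_le {a : ℕ → ℝ} (ha : ∀ i, 0 ≤ a i) (hns : ¬ Summable a) {V : ℝ≥0∞}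
    (h : ∀ n, ∑ i ∈ Finset.range n, ENNReal.ofReal (a i) ≤ V) : V = ⊤ := by
  by_contra hV
  refine hns (summable_of_sum_range_le (c := V.toReal) ha fun n => ?_)
  have := ENNReal.toReal_mono hV (h n)
  rwa [← ENNReal.ofReal_sum_of_nonneg fun i _ => ha i,
    ENNReal.toReal_ofReal (Finset.sum_nonneg fun i _ => ha i)] at this

/-- Raised to the power `1/q`, the inequality says `log³(πk) ≤ c k^s` with `s = 1/q - 1 > 0`: any
power beats the logarithm. -/
lemma eventually_one_div_le_rpow {c q : ℝ} (hc : 0 < c) (hq0 : 0 < q) (hq1 : q < 1) :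
    ∀ᶠ k : ℕ in atTop,
      1 / (k : ℝ) ≤ (c / (k * Real.log (Real.pi * k) ^ 3)) ^ q := by
  set s := 1 / q - 1 with hs
  have hs0 : 0 < s := by rw [hs, sub_pos]; exact (one_lt_div hq0).2 hq1
  have hπ := Real.pi_pos
  have hlo := (isLittleO_log_rpow_rpow_atTop 3 hs0).bound
    (show 0 < c * Real.pi ^ (-s) by positivity)
  have htend : Tendsto (fun k : ℕ => Real.pi * (k : ℝ)) atTop atTop :=
    tendsto_natCast_atTop_atTop.const_mul_atTop hπ
  filter_upwards [htend.eventually hlo, htend.eventually_gt_atTop 1, eventually_gt_atTop 0]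
    with k hk hk1 hk0
  have hkp : (0 : ℝ) < k := by exact_mod_cast hk0
  have hlog : 0 < Real.log (Real.pi * k) := Real.log_pos hk1
  have h3 : Real.log (Real.pi * k) ^ (3 : ℝ) = Real.log (Real.pi * k) ^ 3 := by
    exact_mod_cast Real.rpow_natCast (Real.log (Real.pi * k)) 3
  rw [h3, Real.norm_of_nonneg (by positivity), Real.norm_of_nonneg (by positivity),
    Real.mul_rpow hπ.le hkp.le, mul_assoc, ← mul_assoc (Real.pi ^ (-s)), ← Real.rpow_add hπ,
    neg_add_cancel, Real.rpow_zero, one_mul] at hk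
  have h4 : (1 / (k : ℝ)) ^ (1 / q) ≤ c / (k * Real.log (Real.pi * k) ^ 3) := by
    rw [le_div_iff₀ (by positivity), Real.div_rpow zero_le_one hkp.le, Real.one_rpow,
      div_mul_eq_mul_div, one_mul, div_le_iff₀ (by positivity)]
    calc (k : ℝ) * Real.log (Real.pi * k) ^ 3 ≤ k * (c * k ^ s) := by gcongr
      _ = c * (k ^ (1 : ℝ) * k ^ s) := by rw [Real.rpow_one]; ring
      _ = c * k ^ (1 / q) := by rw [← Real.rpow_add hkp, hs]; congr 2; ring
  calc 1 / (k : ℝ) = ((1 / (k : ℝ)) ^ (1 / q)) ^ q := by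
        rw [← Real.rpow_mul (by positivity), one_div_mul_cancel hq0.ne', Real.rpow_one]
    _ ≤ _ := Real.rpow_le_rpow (by positivity) h4 hq0.le

/-- A continuous function that alternates along a decreasing sequence between `0` and the
`1/p`-th powers of `2c / (k log³ (πk))` has infinite total `(1/p + ε)`-variation. -/
lemma fracTV_eq_top_of_alternating {p ε c : ℝ} (hp : 0 < p) (hε : 0 < ε) (hc : 0 < c)
    {u w : ℝ → ℝ} (hu : Continuous u) (hw : w =ᵐ[volume] u) {x : ℕ → ℝ}
    (hx : ∀ k, 1 ≤ k → x (k + 1) < x k)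
    (hux : ∀ k : ℕ, 1 ≤ k →
      u (x k) = (c * (1 - (-1) ^ k) / (k * Real.log (Real.pi * k) ^ 3)) ^ (1 / p)) :
    fracTV (1 / p + ε) w = ⊤ := by
  have hp' : 0 < 1 / p := one_div_pos.2 hp
  set q := 1 / p * (1 / (1 / p + ε)) with hq
  have hq0 : 0 < q := by positivity
  have hq1 : q < 1 := by rw [hq, mul_one_div, div_lt_one (by positivity)]; linarith
  obtain ⟨N, hN⟩ := eventually_atTop.1
    (eventually_one_div_le_rpow (mul_pos two_pos hc) hq0 hq1)
  have hbase : ∀ k : ℕ, 0 ≤ 2 * c / (k * Real.log (Real.pi * k) ^ 3) := by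
    intro k
    rcases Nat.eq_zero_or_pos k with rfl | hk
    · simp
    · have hk1 : (1 : ℝ) ≤ k := by exact_mod_cast hk
      have : 0 ≤ Real.log (Real.pi * k) := Real.log_nonneg (by nlinarith [Real.pi_gt_three])
      positivity
  have hpow : ∀ k, N ≤ k →
      1 / (k : ℝ) ≤ |(2 * c / (k * Real.log (Real.pi * k) ^ 3)) ^ (1 / p)| ^ (1 / (1 / p + ε)) := by
    intro k hk
    rw [abs_of_nonneg (Real.rpow_nonneg (hbase k) _), ← Real.rpow_mul (hbase k)]
    exact hN k hk
  -- One of `k`, `k + 1` is even and contributes `0`, so the increment is the amplitude at the odd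
  -- one; `1/(k+1)` bounds both cases.
  have hosc : ∀ k, 1 ≤ k → N ≤ k →
      1 / ((k + 1 : ℕ) : ℝ) ≤ |u (x (k + 1)) - u (x k)| ^ (1 / (1 / p + ε)) := by
    intro k hk1 hk
    rw [hux k hk1, hux (k + 1) (by omega)]
    have hz : (0 : ℝ) ^ (1 / p) = 0 := Real.zero_rpow hp'.ne'
    rcases Nat.even_or_odd k with he | ho
    · rw [he.neg_one_pow, he.add_one.neg_one_pow, sub_self, mul_zero, zero_div, hz, sub_zero,
        show c * (1 - -1) = 2 * c by ring]
      exact hpow (k + 1) (by omega)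
    · rw [ho.neg_one_pow, ho.add_one.neg_one_pow, sub_self, mul_zero, zero_div, hz, zero_sub,
        abs_neg, show c * (1 - -1) = 2 * c by ring]
      refine le_trans ?_ (hpow k hk)
      have : (0 : ℝ) < k := by exact_mod_cast hk1
      gcongr
      omega
  refine eq_top_of_sum_le (a := fun i => 1 / ((i + (N + 2) : ℕ) : ℝ)) (fun i => by positivity)
    (fun h => Real.not_summable_one_div_natCast
      ((summable_nat_add_iff (f := fun n : ℕ => 1 / (n : ℝ)) (N + 2)).1 h)) fun n => ?_
  refine le_trans (Finset.sum_le_sum fun i _ => ENNReal.ofReal_le_ofReal ?_)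
    (sum_le_fracTV_of_ae_eq (by positivity) hu hw (n := n) (x := fun i => x (i + (N + 1)))
      fun i _ => ?_)
  · have := hosc (i + (N + 1)) (by omega) (by omega)
    rw [show i + 1 + (N + 1) = i + (N + 1) + 1 by ring]
    exact this
  · rw [show i + 1 + (N + 1) = i + (N + 1) + 1 by ring]
    exact hx _ (by omega)

/-! ### The oscillating velocity profile -/

lemma hasDerivAt_expNegInvGlue (y : ℝ) :
    HasDerivAt expNegInvGlue (y⁻¹ ^ 2 * expNegInvGlue y) y := by
  simpa using expNegInvGlue.hasDerivAt_polynomial_eval_inv_mul 1 y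

lemma expNegInvGlue_le_one (y : ℝ) : expNegInvGlue y ≤ 1 := by
  rw [expNegInvGlue]
  split_ifs with h
  · exact zero_le_one
  · exact Real.exp_le_one_iff.2 (neg_nonpos.2 (inv_pos.2 (not_le.1 h)).le)

/-- A nonnegative `C¹` function with oscillations at `0` whose amplitudes are barely summable. -/
def oscProfile (y : ℝ) : ℝ :=
  y ^ 3 * expNegInvGlue y * (1 - Real.cos (expNegInvGlue y)⁻¹)

/-- The derivative of `oscProfile`. -/
def oscProfileDeriv (y : ℝ) : ℝ :=
  (3 * y ^ 2 + y) * (expNegInvGlue y * (1 - Real.cos (expNegInvGlue y)⁻¹))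
    - y * Real.sin (expNegInvGlue y)⁻¹

lemma oscProfile_of_nonpos {y : ℝ} (hy : y ≤ 0) : oscProfile y = 0 := by
  simp [oscProfile, expNegInvGlue.zero_of_nonpos hy]

lemma oscProfileDeriv_of_nonpos {y : ℝ} (hy : y ≤ 0) : oscProfileDeriv y = 0 := by
  simp [oscProfileDeriv, expNegInvGlue.zero_of_nonpos hy]

lemma oscProfile_nonneg (y : ℝ) : 0 ≤ oscProfile y := by
  rcases le_or_gt y 0 with hy | hy
  · rw [oscProfile_of_nonpos hy]
  · exact mul_nonneg (mul_nonneg (by positivity) (expNegInvGlue.nonneg y))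
      (sub_nonneg.2 (Real.cos_le_one _))

lemma abs_expNegInvGlue_mul_le (y : ℝ) :
    |expNegInvGlue y * (1 - Real.cos (expNegInvGlue y)⁻¹)| ≤ 2 := by
  have h1 := Real.cos_le_one (expNegInvGlue y)⁻¹
  have h2 := Real.neg_one_le_cos (expNegInvGlue y)⁻¹
  have h3 := expNegInvGlue.nonneg y
  have h4 := expNegInvGlue_le_one y
  rw [abs_of_nonneg (mul_nonneg h3 (by linarith))]
  calc _ ≤ 1 * (2 : ℝ) := mul_le_mul h4 (by linarith) (by linarith) zero_le_one
    _ = 2 := one_mul 2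

lemma hasDerivAt_oscProfile (y : ℝ) : HasDerivAt oscProfile (oscProfileDeriv y) y := by
  rcases lt_trichotomy y 0 with hy | rfl | hy
  · rw [oscProfileDeriv_of_nonpos hy.le]
    refine (hasDerivAt_const y (0 : ℝ)).congr_of_eventuallyEq ?_
    filter_upwards [eventually_lt_nhds hy] with z hz
    exact oscProfile_of_nonpos hz.le
  · rw [oscProfileDeriv_of_nonpos le_rfl, hasDerivAt_iff_isLittleO]
    have h1 : (fun z : ℝ => z ^ 3) =o[𝓝 0] fun z : ℝ => z := by
      simpa using Asymptotics.isLittleO_pow_pow (𝕜 := ℝ) (show 1 < 3 by norm_num)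
    simp only [oscProfile_of_nonpos le_rfl, sub_zero, smul_zero]
    refine Asymptotics.IsBigO.trans_isLittleO (Asymptotics.IsBigO.of_bound 2
      (Eventually.of_forall fun z => ?_)) h1
    rw [oscProfile, mul_assoc, norm_mul, mul_comm]
    exact mul_le_mul_of_nonneg_right (abs_expNegInvGlue_mul_le z) (norm_nonneg _)
  · have he : expNegInvGlue y ≠ 0 := (expNegInvGlue.pos_of_pos hy).ne'
    have h1 := hasDerivAt_expNegInvGlue y
    have h2 := ((hasDerivAt_pow 3 y).mul h1).mul ((h1.inv he).cos.const_sub 1)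
    refine h2.congr_deriv ?_
    simp only [oscProfileDeriv]
    have := hy.ne'
    simp only [Pi.mul_apply, Pi.inv_apply]
    field_simp
    push_cast
    ring

/-- Differentiating the phase `e^(1/y)` costs `e^(1/y)/y²`; the prefactor `y³ e^(-1/y)` absorbs it
and leaves `y sin`, which tends to `0`. The cube here is the source of `log³`. -/
lemma continuous_oscProfileDeriv : Continuous oscProfileDeriv := by
  have hec : Continuous expNegInvGlue := expNegInvGlue.contDiff (n := 0).continuous
  rw [continuous_iff_continuousAt]
  intro y
  rcases lt_trichotomy y 0 with hy | rfl | hy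
  · refine (continuousAt_const (y := (0 : ℝ))).congr ?_
    filter_upwards [eventually_lt_nhds hy] with z hz
    exact (oscProfileDeriv_of_nonpos hz.le).symm
  · rw [ContinuousAt, oscProfileDeriv_of_nonpos le_rfl]
    have hb : Tendsto (fun z : ℝ => |3 * z ^ 2 + z| * 2 + |z|) (𝓝 0) (𝓝 0) := by
      have : Continuous fun z : ℝ => |3 * z ^ 2 + z| * 2 + |z| := by fun_prop
      simpa using this.tendsto 0
    refine squeeze_zero_norm (fun z => ?_) hb
    refine (norm_sub_le _ _).trans (add_le_add ?_ ?_)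
    · rw [norm_mul]
      exact mul_le_mul_of_nonneg_left (abs_expNegInvGlue_mul_le z) (norm_nonneg _)
    · rw [norm_mul]
      exact mul_le_of_le_one_right (norm_nonneg _) (Real.abs_sin_le_one _)
  · have he : expNegInvGlue y ≠ 0 := (expNegInvGlue.pos_of_pos hy).ne'
    have hi : ContinuousAt (fun z => (expNegInvGlue z)⁻¹) y := hec.continuousAt.inv₀ he
    have hcos := Real.continuous_cos.continuousAt.comp hi
    have hsin := Real.continuous_sin.continuousAt.comp hi
    exact ((by fun_prop : ContinuousAt (fun z : ℝ => 3 * z ^ 2 + z) y).mul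
      (hec.continuousAt.mul (continuousAt_const.sub hcos))).sub (continuousAt_id.mul hsin)

lemma contDiff_oscProfile : ContDiff ℝ 1 oscProfile := by
  have hd : deriv oscProfile = oscProfileDeriv :=
    funext fun y => (hasDerivAt_oscProfile y).deriv
  rw [contDiff_one_iff_deriv, hd]
  exact ⟨fun y => (hasDerivAt_oscProfile y).differentiableAt, continuous_oscProfileDeriv⟩

lemma one_lt_log_pi_mul {k : ℕ} (hk : 1 ≤ k) : 1 < Real.log (Real.pi * k) := by
  have hk1 : (1 : ℝ) ≤ k := by exact_mod_cast hk
  rw [Real.lt_log_iff_exp_lt (by positivity)]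
  nlinarith [Real.pi_gt_three, Real.exp_one_lt_d9]

lemma oscProfile_apply {k : ℕ} (hk : 1 ≤ k) : oscProfile (Real.log (Real.pi * k))⁻¹ =
    1 / Real.pi * (1 - (-1) ^ k) / (k * Real.log (Real.pi * k) ^ 3) := by
  have hlog := one_lt_log_pi_mul hk
  have hk1 : (0 : ℝ) < k := by exact_mod_cast hk
  have he : expNegInvGlue (Real.log (Real.pi * k))⁻¹ = (Real.pi * k)⁻¹ := by
    rw [expNegInvGlue, if_neg (not_le.2 (inv_pos.2 (by linarith))), inv_inv, Real.exp_neg,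
      Real.exp_log (by positivity)]
  rw [oscProfile, he, inv_inv, mul_comm Real.pi, Real.cos_nat_mul_pi]
  field_simp

/-- A `C¹` velocity profile with arbitrarily small Lipschitz constant and barely summable
oscillations. -/
lemma exists_profile {l : ℝ} (hl : 0 < l) : ∃ b : ℝ → ℝ, ContDiff ℝ 1 b ∧ HasCompactSupport b ∧
    (∀ y, 0 ≤ b y) ∧ (∀ y z, |b y - b z| ≤ l * |y - z|) ∧ ∃ c, 0 < c ∧ ∀ k : ℕ, 1 ≤ k →
      b (Real.log (Real.pi * k))⁻¹ = c * (1 - (-1) ^ k) / (k * Real.log (Real.pi * k) ^ 3) := by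
  let χ : ContDiffBump (0 : ℝ) := ⟨1, 2, one_pos, one_lt_two⟩
  have hsm : ContDiff ℝ 1 fun y => χ y * oscProfile y := χ.contDiff.mul contDiff_oscProfile
  have hsupp : HasCompactSupport fun y => χ y * oscProfile y := χ.hasCompactSupport.mul_right
  obtain ⟨C, hC⟩ := hsm.lipschitzWith_of_hasCompactSupport hsupp one_ne_zero
  -- Scaling makes the Lipschitz constant at most `l`; the `+ 1` covers `C = 0`.
  have hd : 0 < l / (C + 1) := by positivity
  refine ⟨fun y => l / (C + 1) * (χ y * oscProfile y), contDiff_const.mul hsm, hsupp.mul_left,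
    fun y => mul_nonneg hd.le (mul_nonneg χ.nonneg (oscProfile_nonneg y)), fun y z => ?_,
    l / (C + 1) * (1 / Real.pi), by positivity, fun k hk => ?_⟩
  · rw [← mul_sub, abs_mul, abs_of_pos hd]
    have := hC.dist_le_mul y z
    rw [Real.dist_eq, Real.dist_eq] at this
    calc _ ≤ l / (C + 1) * (C * |y - z|) := mul_le_mul_of_nonneg_left this hd.le
      _ = C / (C + 1) * (l * |y - z|) := by ring
      _ ≤ 1 * (l * |y - z|) := by
        gcongr
        exact (div_le_one (by positivity)).2 (by linarith)
      _ = _ := one_mul _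
  · have hlog := one_lt_log_pi_mul hk
    have h1 : χ (Real.log (Real.pi * k))⁻¹ = 1 := by
      refine χ.one_of_mem_closedBall ?_
      rw [mem_closedBall_zero_iff, Real.norm_of_nonneg (by positivity)]
      exact inv_le_one_of_one_le₀ hlog.le
    simp only [h1, one_mul, oscProfile_apply hk]
    ring

/-! ### Transported densities as weak solutions -/

lemma integrable_weight_mul {w g : ℝ → ℝ} {B R : ℝ} (hw : Measurable w) (hB : ∀ y, |w y| ≤ B)
    (hR : ∀ y, R < |y| → w y = 0) (hg : Continuous g) : Integrable fun y => w y * g y := by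
  have h1 : IntegrableOn (fun y => w y * g y) (Set.Icc (-R) R) :=
    (hg.continuousOn.integrableOn_compact isCompact_Icc).bdd_mul hw.aestronglyMeasurable
      (Eventually.of_forall hB)
  have h2 : IntegrableOn (fun y => w y * g y) Set.univ := by
    refine h1.of_forall_sdiff_eq_zero MeasurableSet.univ fun y hy => ?_
    rw [hR y (not_le.1 fun h => hy.2 (abs_le.1 h)), zero_mul]
  rwa [integrableOn_univ] at h2

/-- The density of the image of `v₀ dx` under the flow map `X t`. -/
def transportedDensity (X : ℝ → ℝ → ℝ) (v₀ : ℝ → ℝ) (t x : ℝ) : ℝ :=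
  v₀ (flowInv X t x) * deriv (flowInv X t) x

namespace IsBiLipschitzFlow

variable {X : ℝ → ℝ → ℝ} {m M C : ℝ}

lemma measurable_transportedDensity (H : IsBiLipschitzFlow X m M C) {v₀ : ℝ → ℝ}
    (hv : Measurable v₀) : Measurable (Function.uncurry (transportedDensity X v₀)) := by
  have h1 : Measurable fun q : ℝ × ℝ => v₀ (flowInv X q.1 q.2) :=
    hv.comp H.inv.continuous_uncurry.measurable
  exact h1.mul (measurable_deriv_with_param H.inv.continuous_uncurry)

lemma abs_transportedDensity_le (H : IsBiLipschitzFlow X m M C) {v₀ : ℝ → ℝ} {B : ℝ}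
    (hB : ∀ y, |v₀ y| ≤ B) (t x : ℝ) : |transportedDensity X v₀ t x| ≤ B * m⁻¹ := by
  rw [transportedDensity, abs_mul]
  exact mul_le_mul (hB _) (H.inv.abs_deriv_le t x) (abs_nonneg _) ((abs_nonneg _).trans (hB 0))

lemma flowInv_eq_id (H : IsBiLipschitzFlow X m M C) {t : ℝ} (h : ∀ y, X t y = y) :
    flowInv X t = id := by
  ext x
  have := H.left_inv t x
  rwa [h] at this

/-- The density transported by the flow of the velocity field `c` solves the conservative transport
equation. -/
theorem isWeakTransportSolution (H : IsBiLipschitzFlow X m M C) {c : ℝ → ℝ → ℝ} {T : ℝ}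
    (hc : Continuous (Function.uncurry c))
    (hX : ∀ y, IsCharacteristic c T y fun t => X t y) {v₀ : ℝ → ℝ} {B R : ℝ}
    (hv : Measurable v₀) (hB : ∀ y, |v₀ y| ≤ B) (hR : ∀ y, R < |y| → v₀ y = 0) :
    IsWeakTransportSolution c T v₀ (transportedDensity X v₀) := by
  have hmeas := H.measurable_transportedDensity hv
  refine ⟨memLp_top_of_bound hmeas.aestronglyMeasurable (B * m⁻¹)
    (Eventually.of_forall fun q => H.abs_transportedDensity_le hB q.1 q.2), fun t _ =>
    memLp_top_of_bound (hmeas.comp (measurable_const.prodMk measurable_id)).aestronglyMeasurable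
      (B * m⁻¹) (Eventually.of_forall fun x => H.abs_transportedDensity_le hB t x), ?_, ?_⟩
  · refine Eventually.of_forall fun x => ?_
    simp only [transportedDensity, H.flowInv_eq_id fun y => (hX y).1, id, deriv_id', mul_one]
  intro φ hφ t ht
  have hpush : ∀ (τ : ℝ) (ψ : ℝ → ℝ),
      ∫ x, transportedDensity X v₀ τ x * ψ x = ∫ y, v₀ y * ψ (X τ y) :=
    fun τ ψ => H.integral_pushforward τ v₀ ψ
  -- In Lagrangian coordinates the weak integrand is `v₀(y)` times the derivative of `φ` along the
  -- characteristic from `y`; Fubini and the fundamental theorem of calculus finish.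
  set S : ℝ × ℝ → ℝ := fun q => partialT φ q.1 (X q.1 q.2)
    + c q.1 (X q.1 q.2) * partialX φ q.1 (X q.1 q.2) with hS
  have hXc : Continuous fun q : ℝ × ℝ => (q.1, X q.1 q.2) :=
    continuous_fst.prodMk H.continuous_uncurry
  have hSc : Continuous S :=
    (hφ.continuous_partialT.comp hXc).add ((hc.comp hXc).mul (hφ.continuous_partialX.comp hXc))
  have h0 : ∀ y, X 0 y = y := fun y => (hX y).1
  have hftc : ∀ y, ∫ τ in (0 : ℝ)..t, S (τ, y) = φ (t, X t y) - φ (0, y) := by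
    intro y
    have hd : ∀ τ ∈ Set.Icc 0 T, HasDerivWithinAt (fun τ => φ (τ, X τ y)) (S (τ, y))
        (Set.Icc 0 T) τ := fun τ hτ => hφ.hasDerivWithinAt_along ((hX y).2 τ hτ)
    have h := intervalIntegral.integral_eq_sub_of_hasDerivAt_of_le ht.1
      (f := fun τ => φ (τ, X τ y)) (f' := fun τ => S (τ, y))
      (fun τ hτ => ((hd τ ⟨hτ.1, hτ.2.trans ht.2⟩).continuousWithinAt).mono
        (Set.Icc_subset_Icc_right ht.2))
      (fun τ hτ => (hd τ ⟨hτ.1.le, hτ.2.le.trans ht.2⟩).hasDerivAt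
        (Icc_mem_nhds hτ.1 (hτ.2.trans_le ht.2)))
      ((hSc.comp (by fun_prop : Continuous fun τ : ℝ => (τ, y))).intervalIntegrable _ _)
    rw [h, h0]
  have hint : ∀ τ, Integrable fun y => v₀ y * φ (τ, X τ y) := fun τ =>
    integrable_weight_mul hv hB hR (hφ.smooth.continuous.comp
      (hXc.comp (by fun_prop : Continuous fun y : ℝ => (τ, y))))
  have hswap := integral_weight_mul_swap (a := 0) (c := t) hv hB hSc (R := R)
    fun τ _ y hy => by rw [hR y hy, zero_mul]
  have hint0 := hint 0
  simp only [h0] at hint0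
  simp only [hpush]
  rw [hswap, ← integral_add hint0]
  · refine integral_congr_ae (Eventually.of_forall fun y => ?_)
    simp only [hftc]
    ring
  · simp only [hftc, mul_sub]
    exact (hint t).sub hint0

end IsBiLipschitzFlow

/-! ### The sign pattern and its variation under the flow -/

/-- The function on `(0, 1)` that equals `(-1) ^ k` on `(1 / (k + 1), 1 / k)`. -/
def signPattern : ℝ → ℝ :=
  Set.indicator (Set.Ioo 0 1) fun y => if 0 < Real.sin (Real.pi / y) then 1 else -1

lemma measurable_signPattern : Measurable signPattern := by
  refine Measurable.indicator (Measurable.ite ?_ measurable_const measurable_const) measurableSet_Ioo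
  exact measurableSet_lt measurable_const
    (Real.measurable_sin.comp (measurable_const.div measurable_id))

lemma abs_signPattern_le (y : ℝ) : |signPattern y| ≤ 1 := by
  rw [signPattern, Set.indicator_apply]
  split_ifs <;> simp

lemma signPattern_eq_zero {y : ℝ} (hy : 1 < |y|) : signPattern y = 0 :=
  Set.indicator_of_notMem (fun h => absurd hy (not_lt.2 (abs_le.2 ⟨by linarith [h.1], h.2.le⟩))) _

lemma signPattern_apply {k : ℕ} (hk : 1 ≤ k) {y : ℝ}
    (hy : y ∈ Set.Ioo (1 / ((k : ℝ) + 1)) (1 / k)) : signPattern y = (-1) ^ k := by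
  have hk1 : (1 : ℝ) ≤ k := by exact_mod_cast hk
  have hk0 : (0 : ℝ) < k := by linarith
  have hy0 : 0 < y := (by positivity : (0 : ℝ) < 1 / (k + 1)).trans hy.1
  have hy1 : y < 1 := hy.2.trans_le ((div_le_one hk0).2 hk1)
  have h1 : (k : ℝ) < 1 / y := (lt_one_div hk0 hy0).2 hy.2
  have h2 : 1 / y < k + 1 := (one_div_lt hy0 (by positivity)).2 hy.1
  have hπ := Real.pi_pos
  have hsin : Real.sin (Real.pi / y) = (-1) ^ k * Real.sin (Real.pi * (1 / y - k)) := by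
    rw [← Real.sin_add_nat_mul_pi]
    congr 1
    ring
  have hpos : 0 < Real.sin (Real.pi * (1 / y - k)) :=
    Real.sin_pos_of_pos_of_lt_pi (mul_pos hπ (by linarith))
      (by nlinarith)
  rw [signPattern, Set.indicator_of_mem (Set.mem_Ioo.2 ⟨hy0, hy1⟩)]
  rcases Nat.even_or_odd k with he | ho
  · rw [if_pos, he.neg_one_pow]
    rw [hsin, he.neg_one_pow, one_mul]
    exact hpos
  · rw [if_neg, ho.neg_one_pow]
    rw [hsin, ho.neg_one_pow]
    linarith

/-- The transported sign pattern has infinite fractional variation of every order, whatever the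
flow. -/
lemma fracTV_transportedDensity_eq_top {X : ℝ → ℝ → ℝ} {m M C : ℝ}
    (H : IsBiLipschitzFlow X m M C) {s : ℝ} (hs : 0 < s) (t : ℝ) {w : ℝ → ℝ}
    (hw : w =ᵐ[volume] transportedDensity X signPattern t) : fracTV s w = ⊤ := by
  have hM : 0 < M⁻¹ := H.inv.pos
  have hgood : ∀ᵐ x, w x = transportedDensity X signPattern t x ∧
      DifferentiableAt ℝ (flowInv X t) x :=
    hw.and (H.inv.lipschitzWith t).ae_differentiableAt_real
  have hdense := Measure.dense_of_ae hgood
  -- One sample point in the image of each sign interval, chosen where `w` is the density and the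
  -- inverse flow is differentiable, so that its slope there is at least `M⁻¹`.
  have hex : ∀ k : ℕ, ∃ z ∈ Set.Ioo (X t (1 / ((k : ℝ) + 1 + 1))) (X t (1 / ((k : ℝ) + 1))),
      w z = transportedDensity X signPattern t z ∧ DifferentiableAt ℝ (flowInv X t) z := by
    intro k
    obtain ⟨z, hz1, hz2⟩ := hdense.exists_mem_open isOpen_Ioo
      (Set.nonempty_Ioo.2 (H.strictMono t (show 1 / ((k : ℝ) + 1 + 1) < 1 / ((k : ℝ) + 1) from
        one_div_lt_one_div_of_lt (by positivity) (lt_add_one _))))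
    exact ⟨z, hz2, hz1⟩
  choose z hz hzw hzd using hex
  have hval : ∀ k, w (z k) = (-1) ^ (k + 1) * deriv (flowInv X t) (z k) := by
    intro k
    have hmem : flowInv X t (z k) ∈ Set.Ioo (1 / (((k + 1 : ℕ) : ℝ) + 1)) (1 / ((k + 1 : ℕ) : ℝ)) := by
      have h1 := H.inv.strictMono t (hz k).1
      have h2 := H.inv.strictMono t (hz k).2
      rw [H.left_inv] at h1 h2
      push_cast
      exact ⟨h1, h2⟩
    rw [hzw, transportedDensity, signPattern_apply (by omega) hmem]
  have hosc : ∀ k, M⁻¹ ≤ |w (z (k + 1)) - w (z k)| := by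
    intro k
    have h1 := H.inv.le_deriv (hzd k)
    have h2 := H.inv.le_deriv (hzd (k + 1))
    have he : w (z (k + 1)) - w (z k) = (-1) ^ k *
        (deriv (flowInv X t) (z (k + 1)) + deriv (flowInv X t) (z k)) := by
      rw [hval, hval]; ring
    rw [he, abs_mul, abs_neg_one_pow, one_mul]
    exact le_trans (by linarith) (le_abs_self _)
  refine eq_top_of_sum_le (a := fun _ => M⁻¹ ^ (1 / s)) (fun _ => by positivity)
    (fun h => (Real.rpow_pos_of_pos hM _).ne' ((summable_const_iff _).1 h)) fun n => ?_
  refine le_trans (Finset.sum_le_sum fun i _ => ENNReal.ofReal_le_ofReal ?_)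
    (sum_le_fracTV s w (n := n) (x := z) fun i _ => ?_)
  · exact Real.rpow_le_rpow hM.le (hosc i) (by positivity)
  · have h1 := (hz (i + 1)).2
    have h2 := (hz i).1
    push_cast at h1
    exact h1.trans h2

/-! ### The entropy solution and the final assembly -/

lemma deriv_powerFlux_rpow {p a : ℝ} (hp : 0 < p) (ha : 0 ≤ a) :
    deriv (powerFlux p) (a ^ (1 / p)) = a := by
  have h1 := (hasDerivAt_abs_rpow (a ^ (1 / p)) (show 1 < p + 1 by linarith)).div_const (p + 1)
  have h2 : deriv (powerFlux p) (a ^ (1 / p)) = _ := h1.deriv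
  have hp1 : p + 1 ≠ 0 := by positivity
  rw [h2, abs_of_nonneg (Real.rpow_nonneg ha _)]
  rcases ha.eq_or_lt with rfl | ha
  · rw [Real.zero_rpow (one_div_pos.2 hp).ne', mul_zero, zero_div]
  · have h3 : (a ^ (1 / p)) ^ (p + 1 - 2) * a ^ (1 / p) = a := by
      rw [← Real.rpow_mul ha.le, ← Real.rpow_add ha,
        show 1 / p * (p + 1 - 2) + 1 / p = 1 by field_simp; ring, Real.rpow_one]
    rw [mul_assoc, h3, mul_div_cancel_left₀ _ hp1]

section ClassicalSolution

variable {T p L B : ℝ} {b : ℝ → ℝ}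

lemma continuous_classicalSolution (hT : 0 ≤ T) (hp : 0 < p)
    (hb : ∀ y z, |b y - b z| ≤ L * |y - z|) (hbc : Continuous b) (hLT : L * T ≤ 1 / 2)
    (hB : ∀ y, |b y| ≤ B) : Continuous (Function.uncurry (classicalSolution T p b)) :=
  (hbc.comp (isBiLipschitzFlow_burgersFlow hT hb hLT hB).inv.continuous_uncurry).rpow_const
    fun _ => Or.inr (one_div_pos.2 hp).le

lemma abs_classicalSolution_le (hp : 0 < p) (hb0 : ∀ y, 0 ≤ b y) (hB : ∀ y, |b y| ≤ B)
    (t x : ℝ) : |classicalSolution T p b t x| ≤ B ^ (1 / p) := by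
  rw [classicalSolution, abs_of_nonneg (Real.rpow_nonneg (hb0 _) _)]
  exact Real.rpow_le_rpow (hb0 _) ((le_abs_self _).trans (hB _)) (one_div_pos.2 hp).le

/-- Before the crossing of characteristics the solution given by characteristics is the entropy
solution. -/
theorem isEntropySolution_classicalSolution (hT : 0 ≤ T) (hp : 0 < p)
    (hb1 : ContDiff ℝ 1 b) (hb0 : ∀ y, 0 ≤ b y)
    (hb : ∀ y z, |b y - b z| ≤ L * |y - z|) (hLT : L * T ≤ 1 / 2) (hB : ∀ y, |b y| ≤ B) :
    IsEntropySolution (powerFlux p) T (fun x => b x ^ (1 / p)) (classicalSolution T p b) := by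
  have hc := continuous_classicalSolution hT hp hb hb1.continuous hLT hB
  have hbd := abs_classicalSolution_le (T := T) hp hb0 hB
  have hct : ∀ t, Continuous (classicalSolution T p b t) := fun t =>
    hc.comp (by fun_prop : Continuous fun x : ℝ => (t, x))
  refine ⟨memLp_top_of_bound hc.aestronglyMeasurable _ (Eventually.of_forall fun q => hbd q.1 q.2),
    fun t _ => memLp_top_of_bound (hct t).aestronglyMeasurable _
      (Eventually.of_forall fun x => hbd t x), ?_, fun R t _ => ?_, ?_⟩
  · have h0 : ∀ y, burgersFlow T b 0 y = y := fun y => by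
      rw [burgersFlow, clampTime_of_mem ⟨le_rfl, hT⟩, zero_mul, add_zero]
    refine Eventually.of_forall fun x => ?_
    simp only [classicalSolution,
      (isBiLipschitzFlow_burgersFlow hT hb hLT hB).flowInv_eq_id h0, id]
  · have h1 : Continuous (Function.uncurry fun τ x : ℝ =>
        |classicalSolution T p b τ x - classicalSolution T p b t x|) :=
      (hc.sub ((hct t).comp continuous_snd)).abs
    have h2 := (continuous_parametric_integral_of_continuous (μ := volume) h1
      (isCompact_Icc (a := -R) (b := R))).tendsto t
    simp only [sub_self, abs_zero, integral_zero] at h2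
    exact h2.mono_left nhdsWithin_le_nhds
  · intro k φ hφ _ hφT
    exact (classicalSolution_kruzhkov hT hp hb1 hb0 hb hLT hB k hφ fun x => hφT T x le_rfl).ge

end ClassicalSolution

end

theorem theorem5p1 (T : ℝ) (hT : 0 < T) (p : ℝ) (hp : 1 ≤ p) (h : ℝ → ℝ) (K : ℝ≥0)
    (hh : LipschitzWith K h) :
    ∃ u₀ v₀ : ℝ → ℝ,
      MemLp u₀ ⊤ volume ∧ HasCompactSupport u₀ ∧
      MemLp v₀ ⊤ volume ∧ HasCompactSupport v₀ ∧
      ∃ u v : ℝ → ℝ → ℝ,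
        IsTriangularEntropySolution (powerFlux p) (h ∘ deriv (powerFlux p)) T u₀ v₀ u v ∧
        ContinuousOn (Function.uncurry u) (Set.Icc 0 T ×ˢ Set.univ) ∧
        IsObtainedByCharacteristics (fun t x => (h ∘ deriv (powerFlux p)) (u t x)) T v₀ v ∧
        MemLp (Function.uncurry u) ⊤ (stripMeasure T) ∧
        MemLp (Function.uncurry v) ⊤ (stripMeasure T) ∧
        ∀ t ∈ Set.Icc 0 T,
          (∀ ε : ℝ, 0 < ε → ∀ w : ℝ → ℝ, w =ᵐ[volume] u t → fracTV (1 / p + ε) w = ⊤) ∧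
          (∀ s' : ℝ, s' ∈ Set.Ioc 0 1 → ∀ w : ℝ → ℝ, w =ᵐ[volume] v t → fracTV s' w = ⊤) := by
  have hp0 : 0 < p := by linarith
  obtain ⟨b, hb1, hbs, hb0, hb, γ, hγ, hbγ⟩ := exists_profile (l := 1 / (2 * T)) (by positivity)
  have hLT : 1 / (2 * T) * T ≤ 1 / 2 := le_of_eq (by field_simp)
  obtain ⟨B, hB⟩ : ∃ B, ∀ y, |b y| ≤ B := hbs.exists_bound_of_continuous hb1.continuous
  have hB0 : 0 ≤ B := (abs_nonneg _).trans (hB 0)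
  have HX := isBiLipschitzFlow_burgersFlow hT.le hb hLT hB
  -- Writing the speed through `b` rather than `u` exposes its Lipschitz bound in `x`: `K` from `h`,
  -- `1/(2T)` from `b`, and `(1/2)⁻¹` from the inverse Burgers flow.
  set c : ℝ → ℝ → ℝ := fun t x => h (b (flowInv (burgersFlow T b) t x)) with hc
  have hceq : (fun t x => (h ∘ deriv (powerFlux p)) (classicalSolution T p b t x)) = c := by
    ext t x
    simp only [hc, Function.comp_apply, classicalSolution, deriv_powerFlux_rpow hp0 (hb0 _)]
  have hcc : Continuous (Function.uncurry c) :=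
    hh.continuous.comp (hb1.continuous.comp HX.inv.continuous_uncurry)
  have hcL : ∀ t x x', |c t x - c t x'| ≤ (K * (1 / (2 * T) * (1 / 2)⁻¹)) * |x - x'| := by
    intro t x x'
    calc |c t x - c t x'| ≤ K * |b (flowInv (burgersFlow T b) t x)
          - b (flowInv (burgersFlow T b) t x')| := hh.dist_le_mul _ _
      _ ≤ K * (1 / (2 * T) * ((1 / 2)⁻¹ * |x - x'|)) := by
        gcongr
        refine (hb _ _).trans ?_
        gcongr
        exact HX.inv.abs_sub_le t x x'
      _ = _ := by ring
  have hcM : ∀ t x, |c t x| ≤ |h 0| + K * B := by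
    intro t x
    have h1 : |c t x - h 0| ≤ K * |b (flowInv (burgersFlow T b) t x) - 0| := hh.dist_le_mul _ _
    rw [sub_zero] at h1
    have h2 : (K : ℝ) * |b (flowInv (burgersFlow T b) t x)| ≤ K * B := by gcongr; exact hB _
    have h3 := abs_sub_abs_le_abs_sub (c t x) (h 0)
    linarith
  obtain ⟨X, H, hX⟩ := exists_flow hT.le (by positivity) (by positivity) hcL
    (fun x => hcc.comp (by fun_prop : Continuous fun t : ℝ => (t, x))) hcM
  have hent := isEntropySolution_classicalSolution hT.le hp0 hb1 hb0 hb hLT hB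
  have htr : IsWeakTransportSolution c T signPattern (transportedDensity X signPattern) :=
    H.isWeakTransportSolution hcc hX measurable_signPattern abs_signPattern_le
      fun y hy => signPattern_eq_zero hy
  have huc := continuous_classicalSolution hT.le hp0 hb hb1.continuous hLT hB
  refine ⟨fun x => b x ^ (1 / p), signPattern, (memLp_congr_ae hent.initial).1
    (hent.slice_bounded 0 ⟨le_rfl, hT.le⟩), ?_, ?_, ?_, classicalSolution T p b,
    transportedDensity X signPattern, ⟨hent, ?_⟩, huc.continuousOn, ?_, hent.bounded, htr.bounded,
    fun t _ => ⟨fun ε hε w hw => ?_, fun s hs w hw => ?_⟩⟩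
  · exact hbs.comp_left (g := fun a : ℝ => a ^ (1 / p)) (Real.zero_rpow (one_div_pos.2 hp0).ne')
  · exact memLp_top_of_bound measurable_signPattern.aestronglyMeasurable 1
      (Eventually.of_forall abs_signPattern_le)
  · exact HasCompactSupport.intro (isCompact_Icc (a := (-1 : ℝ)) (b := 1))
      fun y hy => signPattern_eq_zero (not_le.1 fun h => hy (abs_le.1 h))
  · rw [hceq]
    exact htr
  · rw [hceq]
    refine ⟨X, hX, fun x₀ Y hY t ht => ?_, fun t _ => H.isHomeomorph t,
      fun t _ ψ _ _ => H.integral_pushforward t signPattern ψ⟩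
    have := (hY.abs_sub_bounds hcL (hX x₀) ht).2
    rw [sub_self, abs_zero, mul_zero] at this
    exact sub_eq_zero.1 (abs_eq_zero.1 (le_antisymm this (abs_nonneg _)))
  · refine fracTV_eq_top_of_alternating hp0 hε hγ
      (huc.comp (by fun_prop : Continuous fun x : ℝ => (t, x))) hw
      (x := fun k => burgersFlow T b t (Real.log (Real.pi * k))⁻¹) (fun k hk => ?_) fun k hk => ?_
    · refine HX.strictMono t (inv_strictAnti₀ (by linarith [one_lt_log_pi_mul hk]) ?_)
      have hk0 : (0 : ℝ) < k := by exact_mod_cast hk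
      refine Real.log_lt_log (by positivity) ?_
      push_cast
      nlinarith [Real.pi_pos]
    · simp only [Function.comp_apply, Function.uncurry, classicalSolution, HX.left_inv, hbγ k hk]
  · exact fracTV_transportedDensity_eq_top H hs.1 t hw
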